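/- Let $N\ge 1$, $2\le p<\infty$, $1/p+1/q=1$, let $D\subset\mathbb{R}^N$ be bounded and open and let $\Omega$ be open with $\overline\Omega\subset D$. $W_0^{1,p}(S)$ denotes the closure of $C_0^\infty(S)$ in the norm $\big(\int_S\sum_i|\partial_i y|^p\,dx+\int_S|y|^p\,dx\big)^{1/p}$ and $W^{-1,q}(S)$ its dual; functions of $W_0^{1,p}(\Omega)$ are extended by zero to $D$, so that $f\in W^{-1,q}(D)$ acts on them. Write $\langle v,z\rangle=\int_\Omega v z\,dx$ for $v\in L^q(\Omega)$, $z\in L^p(\Omega)$. **Controls.** Let $0<\alpha\le\beta$. $M_p^{\alpha,\beta}(D)$ is the set of symmetric $\mathcal U=[a_{ij}]\in L^\infty(D;\mathbb{R}^{N\times N})$ such that, for a.e. $x\in D$ and all $\zeta,\eta\in\mathbb{R}^N$: $|a_{ij}(x)|\le\beta$ for all $i,j$; $\sum_{i,j}a_{ij}(x)\big(|\zeta_j|^{p-2}\zeta_j-|\eta_j|^{p-2}\eta_j\big)(\zeta_i-\eta_i)\ge 0$; and $\sum_{i,j}a_{ij}(x)|\zeta_j|^{p-2}\zeta_j\zeta_i\ge\alpha\sum_k|\zeta_k|^p$.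 Let $\xi_1,\xi_2\in L^\infty(D)$ with $0\le\xi_1\le\xi_2$ a.e., and let $Q_1,\dots,Q_N\subset W^{-1,q}(D)$ be nonempty, compact and convex. $U_{ad}$ is the set of all $\mathcal U=[u_1,\dots,u_N]\in M_p^{\alpha,\beta}(D)$ (columns $u_i$) with $\xi_1\le a_{ij}\le\xi_2$ a.e. in $D$ for all $i,j$ and $\operatorname{div}u_i\in Q_i$ for all $i$, where $\langle\operatorname{div}u,\varphi\rangle=-\int_D (u,\nabla\varphi)\,dx$ for $\varphi\in W_0^{1,p}(D)$. Assume $U_{ad}\neq\emptyset$. **State operator.** For $y,v\in W_0^{1,p}(\Omega)$ let $$\langle A(\mathcal U,y),v\rangle=\sum_{i,j=1}^N\int_\Omega a_{ij}\,|\partial_j y|^{p-2}\partial_j y\;\partial_i v\,dx+\int_\Omega|y|^{p-2}y\,v\,dx .$$ **Operators of the Hammerstein equation.** Let $B:L^q(\Omega)\to L^p(\Omega)$ be linear, continuous and positive, i.e. $\langle v,Bv\rangle\ge 0$ for all $v$, with a right inverse $B_r^{-1}$: a map from a set $\mathrm{dom}(B_r^{-1})\subset L^p(\Omega)$ to $L^q(\Omega)$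 with $B B_r^{-1}z=z$ on that set (in particular, $\mathrm{dom}(B_r^{-1})$ may be all of $L^p(\Omega)$). Let $F:W_0^{1,p}(\Omega)\times L^p(\Omega)\to L^q(\Omega)$ satisfy: 1. (uniformly semi-bounded variation) for each bounded $Y_0\subset W_0^{1,p}(\Omega)$ there are a seminorm $|||\cdot|||$ on $L^p(\Omega)$ for which the unit ball of $L^p(\Omega)$ is precompact, and continuous functions $C_y:\mathbb{R}_+\times\mathbb{R}_+\to\mathbb{R}$, $y\in Y_0$, with $C_y(r,t)/t\to 0$ as $t\to 0^+$ for all $r>0$, such that $$\langle F(y,z_1)-F(y,z_2),z_1-z_2\rangle\ge-\inf_{y'\in Y_0}C_{y'}\big(R,|||z_1-z_2|||\big)$$ for all $y\in Y_0$ and all $z_1,z_2$ with $\|z_1\|,\|z_2\|\le R$; 2. (radial continuity) for all $y\in W_0^{1,p}(\Omega)$, $z_1,z_2\in L^p(\Omega)$ there is $\varepsilon>0$ such that $\tau\mapsto\langle F(y,z_1+\tau z_2),z_2\rangle$ is continuous on $[0,\varepsilon]$. Let $f\in W^{-1,q}(D)$, and let $g\in L^p(D)$ be such that $g|_\Omega\in\mathrm{dom}(B_r^{-1})$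 and, for each bounded $Y_0\subset W_0^{1,p}(\Omega)$, there is $\lambda>0$ with $$\langle F(y,z)-B_r^{-1}(g|_\Omega),z\rangle\ge 0\quad\text{for all } y\in Y_0 \text{ and all } z\in L^p(\Omega) \text{ with } \|z\|_{L^p(\Omega)}>\lambda .$$ Then the set of admissible triplets $$\Xi_{sol}=\big\{(\mathcal U,y,z)\in U_{ad}\times W_0^{1,p}(\Omega)\times L^p(\Omega):\ A(\mathcal U,y)=f \text{ in } W^{-1,q}(\Omega),\ \ z+BF(y,z)=g \text{ in } L^p(\Omega)\big\}$$ is nonempty. In particular, if $\mathrm{dom}(B_r^{-1})=L^p(\Omega)$ and the last condition holds for every $g\in L^p(D)$, then $\Xi_{sol}\ne\emptyset$ for every $f\in W^{-1,q}(D)$ and every $g\in L^p(D)$. -/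

import Mathlib

open MeasureTheory Set Filter Topology
open scoped ENNReal ContDiff

noncomputable section

namespace Hammerstein

/-- `ℝ^N` with its Euclidean norm and Lebesgue measure. -/
abbrev E (N : ℕ) : Type := EuclideanSpace ℝ (Fin N)

/-- The Lebesgue space `L^r(S)`, for `S ⊆ ℝ^N`. -/
abbrev L {N : ℕ} (r : ℝ≥0∞) (S : Set (E N)) := Lp ℝ r (volume.restrict S)

/-- The ambient space of the pairs `(y, (∂₁y, …, ∂_N y))`, with the norm
`(∫ |y|^p + ∑ᵢ ∫ |∂ᵢ y|^p)^(1/p)`. -/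
abbrev SobolevPair (N : ℕ) (p : ℝ≥0∞) :=
  WithLp p (Lp ℝ p (volume : Measure (E N)) ×
    PiLp p (fun _ : Fin N => Lp ℝ p (volume : Measure (E N))))

/-- `φ ∈ C₀^∞(S)`, extended by zero to `ℝ^N`. -/
structure IsTestFunction {N : ℕ} (S : Set (E N)) (φ : E N → ℝ) : Prop where
  smooth : ContDiff ℝ ∞ φ
  compact : HasCompactSupport φ
  support : tsupport φ ⊆ S

/-- The classical partial derivative `∂φ/∂xᵢ`. -/
def partialDeriv {N : ℕ} (i : Fin N) (φ : E N → ℝ) (x : E N) : ℝ :=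
  fderiv ℝ φ x (EuclideanSpace.single i 1)

/-- The subspace of all `(φ, ∇φ)` with `φ ∈ C₀^∞(S)`. -/
def testPairs {N : ℕ} (p : ℝ≥0∞) [Fact (1 ≤ p)] (S : Set (E N)) :
    Submodule ℝ (SobolevPair N p) where
  carrier := {w | ∃ φ : E N → ℝ, IsTestFunction S φ ∧ w.fst =ᵐ[volume] φ ∧
    ∀ i, w.snd i =ᵐ[volume] partialDeriv i φ}
  add_mem' := by
    rintro v w ⟨φ, hφ, hv, hv'⟩ ⟨ψ, hψ, hw, hw'⟩
    refine ⟨φ + ψ, ⟨hφ.smooth.add hψ.smooth, hφ.compact.add hψ.compact, ?_⟩, ?_, fun i => ?_⟩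
    · exact (tsupport_add φ ψ).trans (union_subset hφ.support hψ.support)
    · exact (Lp.coeFn_add _ _).trans (hv.add hw)
    · refine (Lp.coeFn_add _ _).trans (((hv' i).add (hw' i)).trans (Eventually.of_forall ?_))
      intro x
      have h1 := (hφ.smooth.differentiable (by simp)) x
      have h2 := (hψ.smooth.differentiable (by simp)) x
      simp [partialDeriv, fderiv_add h1 h2]
  zero_mem' := by
    refine ⟨0, ⟨contDiff_const, HasCompactSupport.zero, by simp [tsupport]⟩, ?_, fun i => ?_⟩
    · exact Lp.coeFn_zero ℝ p volume
    · refine (Lp.coeFn_zero ℝ p volume).trans (Eventually.of_forall ?_)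
      intro x
      simp [partialDeriv]
  smul_mem' := by
    rintro c w ⟨φ, hφ, hw, hw'⟩
    refine ⟨c • φ, ⟨hφ.smooth.const_smul c, hφ.compact.smul_left, ?_⟩, ?_, fun i => ?_⟩
    · exact (tsupport_smul_subset_right (fun _ => c) φ).trans hφ.support
    · exact (Lp.coeFn_smul c _).trans (hw.const_smul c)
    · refine (Lp.coeFn_smul c _).trans (((hw' i).const_smul c).trans (Eventually.of_forall ?_))
      intro x
      have h1 := (hφ.smooth.differentiable (by simp)) x
      simp [partialDeriv, fderiv_const_smul h1]

/-- `W₀^{1,p}(S)`: the closure of `C₀^∞(S)` in the norm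
`(∫ |y|^p + ∑ᵢ ∫ |∂ᵢ y|^p)^(1/p)`. Its elements are recorded together with their weak gradient
(both are norm limits of `φ_k`, `∇φ_k`) and extended by zero to `ℝ^N`, so that
`W₀^{1,p}(Ω) ⊆ W₀^{1,p}(D)` whenever `Ω ⊆ D`. -/
def W0 {N : ℕ} (p : ℝ≥0∞) [Fact (1 ≤ p)] (S : Set (E N)) : Submodule ℝ (SobolevPair N p) :=
  (testPairs p S).topologicalClosure

/-- The function `y` underlying an element of `W₀^{1,p}(S)`. -/
def fnVal {N : ℕ} {p : ℝ≥0∞} [Fact (1 ≤ p)] {S : Set (E N)} (y : W0 p S) :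
    Lp ℝ p (volume : Measure (E N)) :=
  (y : SobolevPair N p).fst

/-- The weak partial derivative `∂y/∂xᵢ` of an element of `W₀^{1,p}(S)`. -/
def weakDeriv {N : ℕ} {p : ℝ≥0∞} [Fact (1 ≤ p)] {S : Set (E N)} (y : W0 p S) (i : Fin N) :
    Lp ℝ p (volume : Measure (E N)) :=
  (y : SobolevPair N p).snd i

theorem W0_mono {N : ℕ} (p : ℝ≥0∞) [Fact (1 ≤ p)] {S T : Set (E N)} (h : S ⊆ T) :
    W0 p S ≤ W0 p T := by
  refine Submodule.topologicalClosure_mono ?_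
  rintro w ⟨φ, hφ, hw⟩
  exact ⟨φ, ⟨hφ.smooth, hφ.compact, hφ.support.trans h⟩, hw⟩

/-- Extension by zero, `W₀^{1,p}(S) → W₀^{1,p}(T)` for `S ⊆ T`. -/
def extendZero {N : ℕ} {p : ℝ≥0∞} [Fact (1 ≤ p)] {S T : Set (E N)} (h : S ⊆ T) (v : W0 p S) :
    W0 p T :=
  Submodule.inclusion (W0_mono p h) v

/-- `W^{-1,q}(S)`, the dual space of `W₀^{1,p}(S)`, where `1/p + 1/q = 1`. -/
abbrev WDual {N : ℕ} (p : ℝ≥0∞) [Fact (1 ≤ p)] (S : Set (E N)) := StrongDual ℝ (W0 p S)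

/-- Restriction `L^r(T) → L^r(S)` for `S ⊆ T`. -/
def restrictL {N : ℕ} {r : ℝ≥0∞} {S T : Set (E N)} (h : S ⊆ T) (g : L r T) : L r S :=
  ((Lp.memLp g).mono_measure (Measure.restrict_mono h le_rfl)).toLp g

/-- The function `t ↦ |t|^(p-2) t`. -/
def pw (p : ℝ≥0∞) (t : ℝ) : ℝ := |t| ^ (p.toReal - 2) * t

/-- `L^∞(D; ℝ^{N×N})`. -/
abbrev LinftyMatrix {N : ℕ} (D : Set (E N)) := Matrix (Fin N) (Fin N) (L ⊤ D)

/-- The class `M_p^{α,β}(D)` of coefficient matrices. -/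
structure MClass {N : ℕ} (p : ℝ≥0∞) (α β : ℝ) (D : Set (E N)) (U : LinftyMatrix D) : Prop where
  symm : U.IsSymm
  growth : ∀ᵐ x ∂volume.restrict D, ∀ i j, |U i j x| ≤ β
  monotone : ∀ᵐ x ∂volume.restrict D, ∀ ζ η : Fin N → ℝ,
    0 ≤ ∑ i, ∑ j, U i j x * (pw p (ζ j) - pw p (η j)) * (ζ i - η i)
  coercive : ∀ᵐ x ∂volume.restrict D, ∀ ζ : Fin N → ℝ,
    α * ∑ k, |ζ k| ^ p.toReal ≤ ∑ i, ∑ j, U i j x * pw p (ζ j) * ζ i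

/-- `div u = ℓ` in `W^{-1,q}(D)`, for a vector field `u` on `D`. -/
def HasDiv {N : ℕ} {p : ℝ≥0∞} [Fact (1 ≤ p)] {D : Set (E N)} (u : Fin N → L ⊤ D)
    (ℓ : WDual p D) : Prop :=
  ∀ φ : W0 p D, ℓ φ = -∫ x in D, ∑ k, u k x * weakDeriv φ k x

/-- The set `U_b`. -/
def Ub {N : ℕ} (p : ℝ≥0∞) (α β : ℝ) (D : Set (E N)) (ξ₁ ξ₂ : L ⊤ D) : Set (LinftyMatrix D) :=
  {U | MClass p α β D U ∧ ∀ᵐ x ∂volume.restrict D, ∀ i j, ξ₁ x ≤ U i j x ∧ U i j x ≤ ξ₂ x}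

/-- The set `U_sol`: the divergence of the `i`-th column of `U` belongs to `Qᵢ`. -/
def Usol {N : ℕ} (p : ℝ≥0∞) [Fact (1 ≤ p)] (α β : ℝ) (D : Set (E N))
    (Q : Fin N → Set (WDual p D)) : Set (LinftyMatrix D) :=
  {U | MClass p α β D U ∧ ∀ i, ∃ ℓ ∈ Q i, HasDiv (fun k => U k i) ℓ}

/-- The set `U_ad = U_b ∩ U_sol` of admissible controls of solenoidal type. -/
def Uad {N : ℕ} (p : ℝ≥0∞) [Fact (1 ≤ p)] (α β : ℝ) (D : Set (E N)) (ξ₁ ξ₂ : L ⊤ D)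
    (Q : Fin N → Set (WDual p D)) : Set (LinftyMatrix D) :=
  Ub p α β D ξ₁ ξ₂ ∩ Usol p α β D Q

/-- The pairing `⟨A(U,y), v⟩` for
`A(U,y) = -div(U [(∇y)^{p-2}] ∇y) + |y|^{p-2} y` on `Ω`. -/
def pairA {N : ℕ} {p : ℝ≥0∞} [Fact (1 ≤ p)] {Ω D : Set (E N)} (U : LinftyMatrix D)
    (y v : W0 p Ω) : ℝ :=
  (∑ i, ∑ j, ∫ x in Ω, U i j x * pw p (weakDeriv y j x) * weakDeriv v i x) +
    ∫ x in Ω, pw p (fnVal y x) * fnVal v x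

/-- The duality pairing `⟨v, z⟩ = ∫_Ω v z` between `L^q(Ω)` and `L^p(Ω)`. -/
def dual {N : ℕ} {p q : ℝ≥0∞} {Ω : Set (E N)} (v : L q Ω) (z : L p Ω) : ℝ :=
  ∫ x in Ω, v x * z x

/-- A seminorm `σ` is compact with respect to the norm: norm-bounded sets are `σ`-precompact. -/
def IsCompactSeminorm {Z : Type*} [NormedAddCommGroup Z] [NormedSpace ℝ Z]
    (σ : Seminorm ℝ Z) : Prop :=
  ∀ ε > 0, ∃ t : Set Z, t.Finite ∧ Metric.closedBall (0 : Z) 1 ⊆ ⋃ w ∈ t, σ.ball w ε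

/-- Radial continuity of `G : L^p(Ω) → L^q(Ω)`. -/
def RadiallyContinuous {N : ℕ} {p q : ℝ≥0∞} [Fact (1 ≤ p)] {Ω : Set (E N)}
    (G : L p Ω → L q Ω) : Prop :=
  ∀ z₁ z₂ : L p Ω, ∃ ε > (0 : ℝ),
    ContinuousOn (fun τ : ℝ => dual (G (z₁ + τ • z₂)) z₂) (Icc 0 ε)

/-- Uniformly semi-bounded variation of `F : Y × L^p(Ω) → L^q(Ω)`. The infimum over `Y₀` is
taken in the extended reals. -/
def HasUSBV {N : ℕ} {p q : ℝ≥0∞} [Fact (1 ≤ p)] {Ω : Set (E N)} {Y : Type*}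
    [NormedAddCommGroup Y] (F : Y → L p Ω → L q Ω) : Prop :=
  ∀ Y₀ : Set Y, Bornology.IsBounded Y₀ →
    ∃ (σ : Seminorm ℝ (L p Ω)) (C : Y → ℝ → ℝ → ℝ), IsCompactSeminorm σ ∧
      (∀ y ∈ Y₀, ContinuousOn (fun s : ℝ × ℝ => C y s.1 s.2) (Ici 0 ×ˢ Ici 0) ∧
        ∀ r > 0, Tendsto (fun t => C y r t / t) (𝓝[>] 0) (𝓝 0)) ∧
      ∀ y ∈ Y₀, ∀ (R : ℝ) (z₁ z₂ : L p Ω), ‖z₁‖ ≤ R → ‖z₂‖ ≤ R →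
        -(⨅ y' ∈ Y₀, ((C y' R (σ (z₁ - z₂)) : ℝ) : EReal)) ≤
          ((dual (F y z₁ - F y z₂) (z₁ - z₂) : ℝ) : EReal)

/-- The conditions on the operators `B : L^q(Ω) → L^p(Ω)` (linear and continuous) and
`F : Y × L^p(Ω) → L^q(Ω)` in the existence theorem for the Hammerstein equation
`z + B F(y, z) = g`, `y ∈ Y₀`. The right inverse `Binv` of `B` is defined on a set `dom` that
contains `g`; the usual case of a right inverse on the whole space is `dom = L^p(Ω)`. -/
structure HammersteinConditions {N : ℕ} {p q : ℝ≥0∞} [Fact (1 ≤ p)] [Fact (1 ≤ q)]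
    {Ω : Set (E N)} {Y : Type*} [NormedAddCommGroup Y] (B : L q Ω →L[ℝ] L p Ω)
    (dom : Set (L p Ω)) (Binv : L p Ω → L q Ω) (F : Y → L p Ω → L q Ω) (g : L p Ω)
    (Y₀ : Set Y) : Prop where
  positive : ∀ v : L q Ω, 0 ≤ dual v (B v)
  right_inverse : ∀ z ∈ dom, B (Binv z) = z
  mem_dom : g ∈ dom
  usbv : HasUSBV F
  radial : ∀ y ∈ Y₀, RadiallyContinuous (F y)
  acute : ∃ lam > (0 : ℝ), ∀ y ∈ Y₀, ∀ z : L p Ω, lam < ‖z‖ → 0 ≤ dual (F y z - Binv g) z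

/-- The set `Ξ_sol` of admissible triplets `(U, y, z)`. -/
def XiSol {N : ℕ} {p q : ℝ≥0∞} [Fact (1 ≤ p)] [Fact (1 ≤ q)] {Ω D : Set (E N)} (hΩD : Ω ⊆ D)
    (α β : ℝ) (ξ₁ ξ₂ : L ⊤ D) (Q : Fin N → Set (WDual p D)) (B : L q Ω →L[ℝ] L p Ω)
    (F : W0 p Ω → L p Ω → L q Ω) (f : WDual p D) (g : L p D) :
    Set (LinftyMatrix D × W0 p Ω × L p Ω) :=
  {w | w.1 ∈ Uad p α β D ξ₁ ξ₂ Q ∧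
    (∀ v : W0 p Ω, pairA w.1 w.2.1 v = f (extendZero hΩD v)) ∧
    w.2.2 + B (F w.2.1 w.2.2) = restrictL hΩD g}

end Hammerstein

end

/-! The two equations decouple. Any admissible `U` may be fixed: `A(U, ·)` is monotone, coercive and
radially continuous, so Browder–Minty gives a state `y` (`exists_state`). The Hammerstein equation
is then solved for this single `y`, using its conditions with `Y₀ = {y}`.

For the second step put `z = B v`. It suffices that `v + F(y, B v) - Binv g = 0`, since applying `B`
gives the equation. This reads `0 ∈ L z + G z` with `L = {(B v, v)}` and `G z = F(y, z) - Binv g`.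
Positivity of `B` makes `L` maximal monotone; `G` has semibounded variation and satisfies an acute
angle condition.

`SemiMonotone.exists_solution` solves such inclusions by Galerkin approximation. An ultrafilter
limit of the finite-dimensional solutions is identified by Minty's trick, the compact seminorm in
the variation bound passing to the limit. Browder–Minty is the case of zero seminorm and `L = 0`; it
also yields the Riesz representation of functionals on `L^p`, by inverting `z ↦ |z|^(p-2) z`. Weak
limits come from Clarkson's inequality.

In finite dimensions `G` need not be continuous. If it had no zero, a partition of unity would
produce a nowhere vanishing smooth field equal to `-z` far out, contradicting the no-retraction
theorem. -/

noncomputable section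

namespace Hammerstein

/-! ### The no-retraction theorem, by a volume argument. -/

section NoRetraction

variable {V : Type*} [NormedAddCommGroup V] [InnerProductSpace ℝ V] [FiniteDimensional ℝ V]

theorem exists_polynomial_det_one_add_smul (A : V →L[ℝ] V) :
    ∃ P : Polynomial ℝ, P.natDegree ≤ Module.finrank ℝ V ∧
      ∀ t : ℝ, P.eval t = (1 + t • A).det := by
  classical
  let b := Module.finBasis ℝ V
  let M := LinearMap.toMatrix b b (A : V →ₗ[ℝ] V)
  refine ⟨((Polynomial.X : Polynomial ℝ) • M.map Polynomial.C +
    (1 : Matrix _ _ ℝ).map Polynomial.C).det, ?_, fun t => ?_⟩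
  · simpa using Polynomial.natDegree_det_X_add_C_le M 1
  · rw [ContinuousLinearMap.det, ← LinearMap.det_toMatrix b, ← Polynomial.coe_evalRingHom,
      RingHom.map_det]
    congr 1
    ext i j
    simp only [RingHom.mapMatrix_apply, Matrix.map_apply, Matrix.add_apply, Matrix.smul_apply,
      Polynomial.coe_evalRingHom, smul_eq_mul, Polynomial.eval_add, Polynomial.eval_mul,
      Polynomial.eval_X, Polynomial.eval_C, M, LinearMap.toMatrix_apply, Matrix.one_apply]
    simp [Finsupp.single_apply, add_comm, eq_comm]

/-- `det (1 + t A)` is a polynomial in `t` of degree at most the dimension, so Lagrange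
interpolation at nodes in `(0, δ)` recovers its value at `t = 1`. The weights do not depend on `A`,
hence they can be pulled out of an integral over `A = Df(x) - 1`. -/
theorem exists_det_interpolation {δ : ℝ} (hδ : 0 < δ) :
    ∃ (s : Finset ℝ) (c : ℝ → ℝ), (∀ t ∈ s, 0 < t ∧ t < δ) ∧ ∑ t ∈ s, c t = 1 ∧
      ∀ A : V →L[ℝ] V, (1 + A).det = ∑ t ∈ s, c t * (1 + t • A).det := by
  obtain ⟨s, hs, hcard⟩ := (Set.Ioo_infinite hδ).exists_subset_card_eq (Module.finrank ℝ V + 1)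
  have hinj : Set.InjOn (id : ℝ → ℝ) s := Function.injective_id.injOn
  have hne : s.Nonempty := Finset.card_pos.mp (by omega)
  refine ⟨s, fun t => (Lagrange.basis s id t).eval 1, fun t ht => hs ht, ?_, fun A => ?_⟩
  · rw [← Polynomial.eval_finsetSum, Lagrange.sum_basis hinj hne, Polynomial.eval_one]
  · obtain ⟨P, hP, hPe⟩ := exists_polynomial_det_one_add_smul A
    have hdeg : P.degree < s.card := by
      refine lt_of_le_of_lt Polynomial.degree_le_natDegree ?_
      rw [hcard]
      exact_mod_cast Nat.lt_succ_of_le hP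
    have h := Lagrange.eq_interpolate hinj hdeg
    have h1 : (1 + A).det = P.eval 1 := by rw [hPe, one_smul]
    rw [h1, h, Lagrange.interpolate_apply, Polynomial.eval_finsetSum]
    refine Finset.sum_congr rfl fun t _ => ?_
    simp [hPe, mul_comm]

theorem det_one_add_pos {A : V →L[ℝ] V} (hA : ‖A‖ < 1) : 0 < (1 + A).det := by
  have hne : ∀ s ∈ Icc (0 : ℝ) 1, (1 + s • A).det ≠ 0 := by
    intro s hs
    have h1 : ‖-(s • A)‖ < 1 := by
      rw [norm_neg, norm_smul, Real.norm_of_nonneg hs.1]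
      exact lt_of_le_of_lt (mul_le_of_le_one_left (norm_nonneg _) hs.2) hA
    have h2 : IsUnit (1 + s • A) := by
      have := isUnit_one_sub_of_norm_lt_one h1
      simpa using this
    have h3 : IsUnit ((1 + s • A : V →L[ℝ] V) : V →ₗ[ℝ] V) := by
      obtain ⟨u, hu⟩ := h2
      refine ⟨⟨(u : V →L[ℝ] V), (↑u⁻¹ : V →L[ℝ] V), ?_, ?_⟩, by simp [hu]⟩
      · rw [← ContinuousLinearMap.toLinearMap_mul]; simp
      · rw [← ContinuousLinearMap.toLinearMap_mul]; simp
    exact (h3.map (LinearMap.det : (V →ₗ[ℝ] V) →* ℝ)).ne_zero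
  have hc : ContinuousOn (fun s : ℝ => (1 + s • A).det) (Icc 0 1) := by
    have : Continuous fun s : ℝ => (1 + s • A : V →L[ℝ] V) := by fun_prop
    exact (ContinuousLinearMap.continuous_det.comp this).continuousOn
  by_contra! hle
  have h0 : (0 : ℝ) ∈ Icc ((1 + (1 : ℝ) • A).det) ((1 + (0 : ℝ) • A).det) := by
    constructor
    · simpa using hle
    · simp [ContinuousLinearMap.det]
  obtain ⟨s, hs, hs0⟩ := intermediate_value_Icc' zero_le_one hc h0
  exact hne s hs hs0

omit [FiniteDimensional ℝ V] in
theorem exists_mem_sphere_between {R : ℝ} {x y : V} (hx : ‖x‖ ≤ R) (hy : R ≤ ‖y‖) :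
    ∃ w : V, ‖w‖ = R ∧ ‖x - w‖ ≤ ‖x - y‖ := by
  have hc : ContinuousOn (fun s : ℝ => ‖x + s • (y - x)‖) (Icc 0 1) := by fun_prop
  obtain ⟨s, hs, hsR⟩ := intermediate_value_Icc zero_le_one hc
    (show R ∈ Icc _ _ by constructor <;> simpa)
  refine ⟨x + s • (y - x), hsR, ?_⟩
  have : x - (x + s • (y - x)) = s • (x - y) := by module
  rw [this, norm_smul, Real.norm_of_nonneg hs.1]
  exact mul_le_of_le_one_left (norm_nonneg _) hs.2

omit [FiniteDimensional ℝ V] in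
theorem lipschitzWith_extend_zero {R : ℝ} {K : NNReal} {g : V → V}
    (hg : LipschitzOnWith K g (Metric.closedBall 0 R)) (h0 : ∀ x, ‖x‖ = R → g x = 0) :
    LipschitzWith K ((Metric.closedBall 0 R).indicator g) := by
  refine LipschitzWith.of_dist_le_mul ?_
  have key : ∀ x y : V, ‖x‖ ≤ R → ¬ ‖y‖ ≤ R → ‖g x‖ ≤ K * dist x y := by
    intro x y hx hy
    obtain ⟨w, hw, hxw⟩ := exists_mem_sphere_between hx (le_of_not_ge hy)
    have := hg.dist_le_mul x (by simpa using hx) w (by simp [hw])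
    rw [h0 w hw, dist_zero_right] at this
    refine this.trans ?_
    rw [dist_eq_norm, dist_eq_norm]
    gcongr
  intro x y
  by_cases hx : ‖x‖ ≤ R <;> by_cases hy : ‖y‖ ≤ R
  · rw [indicator_of_mem (by simpa using hx), indicator_of_mem (by simpa using hy)]
    exact hg.dist_le_mul x (by simpa using hx) y (by simpa using hy)
  · rw [indicator_of_mem (by simpa using hx), indicator_of_notMem (by simpa using hy),
      dist_zero_right]
    exact key x y hx hy
  · rw [indicator_of_notMem (by simpa using hx), indicator_of_mem (by simpa using hy),
      dist_zero_left, dist_comm]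
    exact key y x hy hx
  · rw [indicator_of_notMem (by simpa using hx), indicator_of_notMem (by simpa using hy), dist_self]
    positivity

variable [MeasurableSpace V] [BorelSpace V]

/-- For small `t` the map `x ↦ x + t (f x - x)` is a bijection of the ball onto itself with positive
Jacobian, so the change of variables formula gives the volume of the ball. -/
theorem integral_det_perturbation {R : ℝ} {f : V → V} (hf : ContDiff ℝ 1 f)
    (hmaps : ∀ x, ‖x‖ ≤ R → ‖f x‖ ≤ R) (hid : ∀ x, ‖x‖ = R → f x = x) :
    ∃ δ > (0 : ℝ), ∀ t, 0 < t → t < δ →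
      ∫ x in Metric.closedBall (0 : V) R, (1 + t • (fderiv ℝ f x - 1)).det =
        (volume : Measure V).real (Metric.closedBall 0 R) := by
  set S := Metric.closedBall (0 : V) R
  have hScomp : IsCompact S := isCompact_closedBall _ _
  have hfc : Continuous (fderiv ℝ f) := hf.continuous_fderiv (by simp)
  obtain ⟨K₀, hK₀⟩ := hScomp.exists_bound_of_continuousOn
    (f := fun x => fderiv ℝ f x - 1) (by fun_prop)
  set K : NNReal := (max K₀ 0).toNNReal + 1
  have hK : ∀ x ∈ S, ‖fderiv ℝ f x - 1‖ ≤ K := by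
    intro x hx
    have : (K : ℝ) = max K₀ 0 + 1 := by simp [K]
    rw [this]
    linarith [hK₀ x hx, le_max_left K₀ 0]
  have hKpos : (0 : ℝ) < K := by positivity
  have hfd : Differentiable ℝ f := hf.differentiable (by simp)
  have hgd : ∀ x, HasFDerivAt (fun x => f x - x) (fderiv ℝ f x - 1) x := fun x =>
    (hfd x).hasFDerivAt.sub (hasFDerivAt_id x)
  have hgL : LipschitzOnWith K (fun x => f x - x) S := by
    refine Convex.lipschitzOnWith_of_nnnorm_hasFDerivWithin_le
      (f' := fun x => fderiv ℝ f x - 1) (fun x _ => (hgd x).hasFDerivWithinAt) ?_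
      (convex_closedBall _ _)
    intro x hx
    exact_mod_cast hK x hx
  have hgE := lipschitzWith_extend_zero hgL (fun x hx => by rw [hid x hx, sub_self])
  -- `t < 1` keeps the ball invariant by convexity; `t K < 1` gives injectivity, surjectivity and a
  -- positive Jacobian.
  refine ⟨min 1 (K : ℝ)⁻¹, by positivity, fun t ht0 ht => ?_⟩
  have ht1 : t < 1 := ht.trans_le (min_le_left _ _)
  have htK : t * K < 1 := by
    have := ht.trans_le (min_le_right _ _)
    rwa [lt_inv_comm₀ ht0 hKpos, lt_inv_comm₀ hKpos ht0, ← one_div, lt_div_iff₀ hKpos] at this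
  have himage : (fun x => x + t • (f x - x)) '' S = S := by
    apply Subset.antisymm
    · rintro _ ⟨x, hx, rfl⟩
      have hx' : ‖x‖ ≤ R := by simpa [S] using hx
      have : x + t • (f x - x) = (1 - t) • x + t • f x := by module
      simp only [S, mem_closedBall_zero_iff]
      rw [this]
      calc ‖(1 - t) • x + t • f x‖ ≤ (1 - t) * ‖x‖ + t * ‖f x‖ := by
            refine (norm_add_le _ _).trans ?_
            rw [norm_smul, norm_smul, Real.norm_of_nonneg ht0.le, Real.norm_of_nonneg (by linarith)]
        _ ≤ (1 - t) * R + t * R := by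
            have := hmaps x hx'
            have : 0 ≤ 1 - t := by linarith
            gcongr
        _ = R := by ring
    · intro y hy
      -- A fixed point of `T` is a preimage of `y`. Since `f - id` vanishes on the sphere, its
      -- extension by zero is still `K`-Lipschitz, so `T` contracts the whole space; a fixed point
      -- outside the ball would equal `y`, which lies inside.
      set T : V → V := fun x => y - t • S.indicator (fun x => f x - x) x
      have hT : ContractingWith (t.toNNReal * K) T := by
        refine ⟨?_, LipschitzWith.of_dist_le_mul fun a b => ?_⟩
        · rw [← NNReal.coe_lt_coe]
          simpa [ht0.le] using htK
        · have := hgE.dist_le_mul a b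
          simp only [T, dist_sub_left, dist_smul₀, Real.norm_of_nonneg ht0.le, NNReal.coe_mul,
            Real.coe_toNNReal _ ht0.le]
          rw [mul_assoc]
          gcongr
      obtain ⟨x, hx⟩ : ∃ x, T x = x := ⟨_, hT.fixedPoint_isFixedPt⟩
      by_cases hxS : x ∈ S
      · refine ⟨x, hxS, ?_⟩
        simp only [T, indicator_of_mem hxS] at hx
        simp only
        nth_rewrite 1 [← hx]
        module
      · simp only [T, indicator_of_notMem hxS, smul_zero, sub_zero] at hx
        exact absurd (hx ▸ hy) hxS
  have hinj : InjOn (fun x => x + t • (f x - x)) S := by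
    intro x hx y hy hxy
    by_contra hne
    have hpos : 0 < dist x y := dist_pos.mpr hne
    have h1 : x - y = t • ((f y - y) - (f x - x)) := by
      have h2 : x + t • (f x - x) = y + t • (f y - y) := hxy
      rw [smul_sub, sub_eq_sub_iff_add_eq_add, h2, add_comm]
    have h2 := hgL.dist_le_mul y hy x hx
    have h3 : dist x y ≤ t * (K * dist x y) := by
      conv_lhs => rw [dist_eq_norm, h1, norm_smul, Real.norm_of_nonneg ht0.le]
      rw [dist_comm x y, ← dist_eq_norm]
      gcongr
    nlinarith
  have hdet := lintegral_abs_det_fderiv_eq_addHaar_image (volume : Measure V)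
    (f := fun x => x + t • (f x - x)) (f' := fun x => 1 + t • (fderiv ℝ f x - 1))
    hScomp.measurableSet
    (fun x _ => ((hasFDerivAt_id x).add ((hgd x).const_smul t)).hasFDerivWithinAt) hinj
  rw [himage] at hdet
  have hpos : ∀ x ∈ S, 0 < (1 + t • (fderiv ℝ f x - 1)).det := by
    intro x hx
    apply det_one_add_pos
    rw [norm_smul, Real.norm_of_nonneg ht0.le]
    exact lt_of_le_of_lt (by gcongr; exact hK x hx) htK
  have hcont : Continuous fun x => (1 + t • (fderiv ℝ f x - 1)).det :=
    ContinuousLinearMap.continuous_det.comp (by fun_prop)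
  rw [integral_eq_lintegral_of_nonneg_ae _ hcont.aestronglyMeasurable, measureReal_def, ← hdet]
  · congr 1
    refine setLIntegral_congr_fun hScomp.measurableSet fun x hx => ?_
    rw [abs_of_pos (hpos x hx)]
  · filter_upwards [ae_restrict_mem hScomp.measurableSet] with x hx using (hpos x hx).le

/-- Without a zero, `R q / ‖q‖` would be a `C¹` retraction onto a sphere, with singular derivative
everywhere. Interpolating the volume identity from small `t` to `t = 1` would then make the volume
of the ball zero. -/
theorem exists_zero_of_eq_id_outside {q : V → V} (hq : ContDiff ℝ 1 q) {r : ℝ}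
    (hid : ∀ x, r ≤ ‖x‖ → q x = x) : ∃ x, q x = 0 := by
  by_contra! hne
  set R := max r 1
  have hR : 0 < R := lt_max_of_lt_right one_pos
  set f : V → V := fun x => (R * ‖q x‖⁻¹) • q x
  have hfn : ∀ x, ‖f x‖ = R := by
    intro x
    have : ‖q x‖ ≠ 0 := norm_ne_zero_iff.mpr (hne x)
    simp only [f, norm_smul, norm_mul, norm_inv, norm_norm, Real.norm_of_nonneg hR.le]
    field_simp
  have hf : ContDiff ℝ 1 f :=
    (contDiff_const.mul ((hq.norm ℝ hne).inv fun x => norm_ne_zero_iff.mpr (hne x))).smul hq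
  have hfid : ∀ x, ‖x‖ = R → f x = x := by
    intro x hx
    have : q x = x := hid x (hx ▸ le_max_left _ _)
    simp only [f, this, hx]
    rw [mul_inv_cancel₀ hR.ne', one_smul]
  obtain ⟨δ, hδ, hint⟩ := integral_det_perturbation hf (fun x _ => (hfn x).le) hfid
  obtain ⟨s, c, hs, hsum, hdet⟩ := exists_det_interpolation (V := V) hδ
  have hfc : Continuous (fderiv ℝ f) := hf.continuous_fderiv (by simp)
  -- Differentiating the constant `‖f‖²` gives `⟨f x, Df(x) v⟩ = 0` for all `v`; were `Df(x)` onto,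
  -- `Df(x) v = f x` would force `f x = 0`.
  have hzero : ∀ x, (fderiv ℝ f x).det = 0 := by
    intro x
    by_contra hd
    have hsurj : Function.Surjective (fderiv ℝ f x) := by
      exact (LinearMap.equivOfDetNeZero (fderiv ℝ f x : V →ₗ[ℝ] V) hd).surjective
    obtain ⟨v, hv⟩ := hsurj (f x)
    have hfd := ((hf.differentiable (by simp)) x).hasFDerivAt
    have h1 : HasFDerivAt (fun y => ‖f y‖ ^ 2) (2 • (innerSL ℝ (f x)).comp (fderiv ℝ f x)) x :=
      hfd.norm_sq
    have h2 : HasFDerivAt (fun y => ‖f y‖ ^ 2) (0 : V →L[ℝ] ℝ) x := by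
      simp only [hfn]
      exact hasFDerivAt_const _ _
    have h3 := congrArg (fun L : V →L[ℝ] ℝ => L v) (h1.unique h2)
    simp [hv] at h3
    have := hfn x
    rw [h3, norm_zero] at this
    exact hR.ne this
  have hI : ∀ t ∈ s, IntegrableOn (fun x => c t * (1 + t • (fderiv ℝ f x - 1)).det)
      (Metric.closedBall (0 : V) R) := fun t _ =>
    (continuous_const.mul (ContinuousLinearMap.continuous_det.comp
      (by fun_prop))).continuousOn.integrableOn_compact (isCompact_closedBall _ _)
  have h1 : ∫ x in Metric.closedBall (0 : V) R, (1 + (fderiv ℝ f x - 1)).det =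
      (volume : Measure V).real (Metric.closedBall 0 R) := by
    rw [setIntegral_congr_fun measurableSet_closedBall
      (fun x _ => hdet (fderiv ℝ f x - 1))]
    rw [integral_finsetSum _ hI]
    have : ∀ t ∈ s, ∫ x in Metric.closedBall (0 : V) R, c t * (1 + t • (fderiv ℝ f x - 1)).det =
        c t * (volume : Measure V).real (Metric.closedBall 0 R) := fun t ht => by
      rw [integral_const_mul, hint t (hs t ht).1 (hs t ht).2]
    rw [Finset.sum_congr rfl this, ← Finset.sum_mul, hsum, one_mul]
  rw [setIntegral_congr_fun (g := fun _ => (0 : ℝ)) measurableSet_closedBall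
    (fun x _ => by simp only [add_sub_cancel, hzero]), integral_zero] at h1
  have h2 : 0 < (volume : Measure V).real (Metric.closedBall 0 R) := by
    rw [measureReal_def]
    exact ENNReal.toReal_pos (Metric.measure_closedBall_pos _ _ hR).ne'
      (isCompact_closedBall _ _).measure_lt_top.ne
  linarith

end NoRetraction

/-! ### Weak limits from Clarkson's inequality, and compact seminorms. -/

section WeakLimit

variable {X : Type*} [NormedAddCommGroup X] [NormedSpace ℝ X]

/-- Clarkson's first inequality with exponent `r`. -/
def ClarksonInequality (X : Type*) [NormedAddCommGroup X] [NormedSpace ℝ X] (r : ℝ) : Prop :=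
  ∀ a b : X, ‖(1 / 2 : ℝ) • (a + b)‖ ^ r + ‖(1 / 2 : ℝ) • (a - b)‖ ^ r ≤
    (‖a‖ ^ r + ‖b‖ ^ r) / 2

/-- A bounded family in a uniformly convex space has a weak cluster point, which moreover lies in
every closed convex set that eventually contains the family. -/
theorem ClarksonInequality.exists_weak_limit [CompleteSpace X] {r : ℝ}
    (hX : ClarksonInequality X r) (hr : 0 < r) {ι : Type*} (l : Filter ι) [l.NeBot] (x : ι → X)
    {R : ℝ} (hx : ∀ i, ‖x i‖ ≤ R) :
    ∃ z : X, ∀ K : Set X, Convex ℝ K → IsClosed K → (∀ᶠ i in l, x i ∈ K) → z ∈ K := by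
  let 𝒦 := {K : Set X // Convex ℝ K ∧ IsClosed K ∧ ∀ᶠ i in l, x i ∈ K}
  have huniv : 𝒦 := ⟨univ, convex_univ, isClosed_univ, Eventually.of_forall fun _ => mem_univ _⟩
  have hKne : ∀ K : 𝒦, ∃ i, x i ∈ K.1 := fun K => K.2.2.2.exists
  have hbdd : BddAbove (range fun K : 𝒦 => Metric.infDist 0 K.1) := by
    refine ⟨R, ?_⟩
    rintro _ ⟨K, rfl⟩
    obtain ⟨i, hi⟩ := hKne K
    refine (Metric.infDist_le_dist_of_mem hi).trans ?_
    simpa using hx i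
  have : Nonempty 𝒦 := ⟨huniv⟩
  -- The limit sought is the smallest-norm point common to all these convex sets; `D` plays the role
  -- of its norm, and the `S j` are sets of near-minimizers.
  set D := ⨆ K : 𝒦, Metric.infDist 0 K.1
  have hD0 : 0 ≤ D := Real.iSup_nonneg fun K => Metric.infDist_nonneg
  let S : 𝒦 × {e : ℝ // 0 < e} → Set X := fun j => {y | y ∈ j.1.1 ∧ ‖y‖ ≤ D + j.2.1}
  have hSne : ∀ j, (S j).Nonempty := by
    rintro ⟨K, e, he⟩
    have h1 : Metric.infDist 0 K.1 < D + e := by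
      have := le_ciSup hbdd K
      linarith
    obtain ⟨i, hi⟩ := hKne K
    obtain ⟨y, hy, hy'⟩ := (Metric.infDist_lt_iff ⟨_, hi⟩).mp h1
    exact ⟨y, hy, by simpa using hy'.le⟩
  have hdir : Directed (· ≥ ·) fun j => 𝓟 (S j) := by
    rintro ⟨K, e, he⟩ ⟨K', e', he'⟩
    refine ⟨⟨⟨K.1 ∩ K'.1, K.2.1.inter K'.2.1, K.2.2.1.inter K'.2.2.1, K.2.2.2.and K'.2.2.2⟩,
      min e e', lt_min he he'⟩, ?_, ?_⟩
    · refine principal_mono.mpr fun y hy => ⟨hy.1.1, hy.2.trans ?_⟩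
      simp
    · refine principal_mono.mpr fun y hy => ⟨hy.1.2, hy.2.trans ?_⟩
      simp
  have : Nonempty (𝒦 × {e : ℝ // 0 < e}) := ⟨⟨huniv, 1, one_pos⟩⟩
  have hcauchy : Cauchy (⨅ j, 𝓟 (S j)) := by
    rw [Metric.cauchy_iff]
    refine ⟨iInf_neBot_of_directed' hdir fun j => principal_neBot_iff.mpr (hSne j), ?_⟩
    intro ε hε
    have hcont : Tendsto (fun η : ℝ => (D + η) ^ r - (max (D - η) 0) ^ r) (𝓝[>] 0) (𝓝 0) := by
      have h1 : Continuous fun η : ℝ => (D + η) ^ r - (max (D - η) 0) ^ r := by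
        refine Continuous.sub ?_ ?_
        · exact (Real.continuous_rpow_const hr.le).comp (by fun_prop)
        · exact (Real.continuous_rpow_const hr.le).comp (by fun_prop)
      have h2 := h1.tendsto 0
      simp only [add_zero, sub_zero, max_eq_left hD0, sub_self] at h2
      exact h2.mono_left nhdsWithin_le_nhds
    obtain ⟨η, hη, hη0⟩ := ((hcont.eventually_lt_const
      (show 0 < (ε / 2) ^ r by positivity)).and self_mem_nhdsWithin).exists
    obtain ⟨K, hK⟩ := exists_lt_of_lt_ciSup (show D - η < D from sub_lt_self _ hη0)
    refine ⟨S (K, ⟨η, hη0⟩), mem_iInf_of_mem _ (mem_principal_self _), ?_⟩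
    rintro y ⟨hy, hyn⟩ w ⟨hw, hwn⟩
    -- The midpoint stays in `K`, so its norm is at least `D - η`, while `y` and `w` have norm at
    -- most `D + η`. Clarkson's inequality then makes `y - w` small.
    have hmid : (1 / 2 : ℝ) • (y + w) ∈ K.1 := by
      rw [smul_add]
      exact K.2.1 hy hw (by norm_num) (by norm_num) (by norm_num)
    have h1 : max (D - η) 0 ≤ ‖(1 / 2 : ℝ) • (y + w)‖ := by
      refine max_le (hK.le.trans ?_) (norm_nonneg _)
      simpa using Metric.infDist_le_dist_of_mem (x := 0) hmid
    have h2 := hX y w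
    have h3 : (max (D - η) 0) ^ r ≤ ‖(1 / 2 : ℝ) • (y + w)‖ ^ r := by gcongr
    have h4 : ‖y‖ ^ r ≤ (D + η) ^ r := by gcongr
    have h5 : ‖w‖ ^ r ≤ (D + η) ^ r := by gcongr
    have h6 : ‖(1 / 2 : ℝ) • (y - w)‖ ^ r < (ε / 2) ^ r := by linarith
    have h7 := (Real.rpow_lt_rpow_iff (norm_nonneg _) (by positivity) hr).mp h6
    rw [norm_smul, Real.norm_of_nonneg (by norm_num)] at h7
    rw [dist_eq_norm]
    linarith
  obtain ⟨z, hz⟩ := CompleteSpace.complete hcauchy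
  have := hcauchy.1
  refine ⟨z, fun K hK hKc hKx => ?_⟩
  refine hKc.mem_of_frequently_of_tendsto (f := id) (b := ⨅ j, 𝓟 (S j))
    (Eventually.frequently ?_) hz
  exact mem_iInf_of_mem (⟨⟨K, hK, hKc, hKx⟩, 1, one_pos⟩ : 𝒦 × {e : ℝ // 0 < e})
    (mem_principal.mpr fun y hy => hy.1)

theorem IsCompactSeminorm.exists_le {σ : Seminorm ℝ X} (hσ : IsCompactSeminorm σ) :
    ∃ C > 0, ∀ x, σ x ≤ C * ‖x‖ := by
  obtain ⟨t, ht, hcov⟩ := hσ 1 one_pos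
  obtain ⟨M, hM⟩ := (ht.image σ).bddAbove
  have hball : ∀ x, ‖x‖ ≤ 1 → σ x ≤ max M 0 + 1 := by
    intro x hx
    obtain ⟨w, hw, hxw⟩ := mem_iUnion₂.mp (hcov (mem_closedBall_zero_iff.mpr hx))
    rw [Seminorm.mem_ball] at hxw
    have h1 : σ x ≤ σ (x - w) + σ w := by simpa using map_add_le_add σ (x - w) w
    have h2 : σ w ≤ M := hM ⟨w, hw, rfl⟩
    linarith [le_max_left M 0]
  refine ⟨max M 0 + 1, by positivity, fun x => ?_⟩
  rcases eq_or_ne x 0 with rfl | hx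
  · simp
  · have hx' : 0 < ‖x‖ := norm_pos_iff.mpr hx
    have h := hball (‖x‖⁻¹ • x) (by rw [norm_smul]; simp [hx'.ne'])
    rw [map_smul_eq_mul, norm_inv, norm_norm, inv_mul_le_iff₀ hx'] at h
    linarith

theorem IsCompactSeminorm.continuous {σ : Seminorm ℝ X} (hσ : IsCompactSeminorm σ) :
    Continuous σ := by
  obtain ⟨C, hC, h⟩ := hσ.exists_le
  exact Seminorm.continuous_of_le (q := C.toNNReal • normSeminorm ℝ X)
    (by exact (continuous_norm.const_smul (C.toNNReal))) (fun x => by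
      simpa [NNReal.smul_def, hC.le] using h x)

/-- Along an ultrafilter, a compact seminorm is continuous for weak convergence. -/
theorem IsCompactSeminorm.tendsto {σ : Seminorm ℝ X} (hσ : IsCompactSeminorm σ) {ι : Type*}
    (l : Ultrafilter ι) {x : ι → X} {R : ℝ} (hx : ∀ i, ‖x i‖ ≤ R) {z : X}
    (hz : ∀ K : Set X, Convex ℝ K → IsClosed K → (∀ᶠ i in (l : Filter ι), x i ∈ K) → z ∈ K)
    (y : X) : Tendsto (fun i => σ (x i - y)) l (𝓝 (σ (z - y))) := by
  have key : ∀ ε > 0, ∀ᶠ i in (l : Filter ι), σ (x i - z) < ε := by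
    intro ε hε
    set ρ := max R 1
    have hρ : 0 < ρ := lt_max_of_lt_right one_pos
    obtain ⟨t, ht, hcov⟩ := hσ (ε / (4 * ρ)) (by positivity)
    have h1 : ∀ i, ∃ w ∈ t, σ (x i - ρ • w) ≤ ε / 4 := by
      intro i
      have : ρ⁻¹ • x i ∈ Metric.closedBall (0 : X) 1 := by
        rw [mem_closedBall_zero_iff, norm_smul, norm_inv, Real.norm_of_nonneg hρ.le,
          inv_mul_le_iff₀ hρ, mul_one]
        exact (hx i).trans (le_max_left _ _)
      obtain ⟨w, hw, hxw⟩ := mem_iUnion₂.mp (hcov this)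
      refine ⟨w, hw, ?_⟩
      rw [Seminorm.mem_ball] at hxw
      have : x i - ρ • w = ρ • (ρ⁻¹ • x i - w) := by
        rw [smul_sub, smul_inv_smul₀ hρ.ne']
      rw [this, map_smul_eq_mul, Real.norm_of_nonneg hρ.le]
      calc ρ * σ (ρ⁻¹ • x i - w) ≤ ρ * (ε / (4 * ρ)) := by gcongr
        _ = ε / 4 := by field_simp
    -- An ultrafilter selects one ball of the finite cover. A closed `σ`-ball is convex and
    -- norm-closed, so it contains the weak limit `z` as well.
    have h2 : ∃ w ∈ t, ∀ᶠ i in (l : Filter ι), σ (x i - ρ • w) ≤ ε / 4 := by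
      have : (⋃ w ∈ t, {i | σ (x i - ρ • w) ≤ ε / 4}) ∈ (l : Filter ι) := by
        refine Filter.mem_of_superset univ_mem fun i _ => ?_
        obtain ⟨w, hw, h⟩ := h1 i
        exact mem_iUnion₂.mpr ⟨w, hw, h⟩
      obtain ⟨w, hw, h⟩ := (Ultrafilter.finite_biUnion_mem_iff ht).mp this
      exact ⟨w, hw, h⟩
    obtain ⟨w, -, hw⟩ := h2
    have h3 : z ∈ σ.closedBall (ρ • w) (ε / 4) := by
      refine hz _ (σ.convex_closedBall _ _) ?_ ?_
      · have : σ.closedBall (ρ • w) (ε / 4) = (fun y => σ (y - ρ • w)) ⁻¹' Iic (ε / 4) := by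
          ext y; simp [Seminorm.mem_closedBall]
        rw [this]
        exact isClosed_Iic.preimage (hσ.continuous.comp (by fun_prop))
      · filter_upwards [hw] with i hi using (Seminorm.mem_closedBall σ).mpr hi
    rw [Seminorm.mem_closedBall] at h3
    filter_upwards [hw] with i hi
    have h4 : σ (x i - z) ≤ σ (x i - ρ • w) + σ (z - ρ • w) := by
      have := map_sub_le_add σ (x i - ρ • w) (z - ρ • w)
      simpa using this
    linarith
  rw [Metric.tendsto_nhds]
  intro ε hε
  filter_upwards [key ε hε] with i hi
  refine lt_of_le_of_lt ?_ hi
  rw [Real.dist_eq]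
  have := abs_sub_map_le_sub σ (x i - y) (z - y)
  simpa using this

end WeakLimit

/-! ### Semimonotone operators and the finite-dimensional equation. -/

section SemiMonotone

variable {X : Type*} [NormedAddCommGroup X] [NormedSpace ℝ X]

/-- Radially continuous operators of semibounded variation on the ball of radius `R`. -/
structure SemiMonotone (R : ℝ) (σ : Seminorm ℝ X) (c : ℝ → ℝ) (G : X → StrongDual ℝ X) :
    Prop where
  continuousOn : ContinuousOn c (Ici 0)
  tendsto : Tendsto (fun t => c t / t) (𝓝[>] 0) (𝓝 0)
  bound : ∀ x y, ‖x‖ ≤ R → ‖y‖ ≤ R → -c (σ (x - y)) ≤ (G x - G y) (x - y)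
  radial : ∀ x h, ∃ ε > (0 : ℝ), ContinuousOn (fun τ : ℝ => G (x + τ • h) h) (Icc 0 ε)

namespace SemiMonotone

variable {R : ℝ} {σ : Seminorm ℝ X} {c : ℝ → ℝ} {G : X → StrongDual ℝ X}

theorem gauge_zero (hG : SemiMonotone R σ c G) : c 0 = 0 := by
  have h1 : Tendsto c (𝓝[>] 0) (𝓝 (c 0)) :=
    (hG.continuousOn 0 self_mem_Ici).mono_left (nhdsWithin_mono _ Ioi_subset_Ici_self)
  have h2 : Tendsto (fun t => c t / t * t) (𝓝[>] 0) (𝓝 (0 * 0)) :=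
    hG.tendsto.mul (tendsto_id.mono_left nhdsWithin_le_nhds)
  rw [zero_mul] at h2
  refine tendsto_nhds_unique h1 (h2.congr' ?_)
  filter_upwards [self_mem_nhdsWithin] with t ht
  exact div_mul_cancel₀ _ (ne_of_gt ht)

theorem tendsto_gauge (hG : SemiMonotone R σ c G) {s : ℝ} (hs : 0 ≤ s) :
    Tendsto (fun τ => c (τ * s) / τ) (𝓝[>] 0) (𝓝 0) := by
  rcases hs.eq_or_lt with rfl | hs
  · simp [hG.gauge_zero]
  · have h1 : Tendsto (fun τ : ℝ => τ * s) (𝓝[>] 0) (𝓝[>] 0) := by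
      refine tendsto_nhdsWithin_iff.mpr ⟨?_, ?_⟩
      · have : Tendsto (fun τ : ℝ => τ * s) (𝓝 0) (𝓝 (0 * s)) := tendsto_id.mul_const s
        rw [zero_mul] at this
        exact this.mono_left nhdsWithin_le_nhds
      · filter_upwards [self_mem_nhdsWithin] with τ hτ using mul_pos hτ hs
    have h2 := (hG.tendsto.comp h1).mul_const s
    rw [zero_mul] at h2
    refine h2.congr fun τ => ?_
    simp only [Function.comp]
    field_simp

theorem tendsto_radial (hG : SemiMonotone R σ c G) (x h : X) :
    Tendsto (fun τ : ℝ => G (x + τ • h) h) (𝓝[>] 0) (𝓝 (G x h)) := by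
  obtain ⟨ε, hε, hc⟩ := hG.radial x h
  have h1 := hc 0 (left_mem_Icc.mpr hε.le)
  simp only [ContinuousWithinAt, zero_smul, add_zero] at h1
  refine h1.mono_left ?_
  rw [← nhdsWithin_Ioo_eq_nhdsGT hε]
  exact nhdsWithin_mono _ Ioo_subset_Icc_self

theorem eventually_norm_le {z : X} (hz : ‖z‖ < R) (h : X) :
    ∀ᶠ τ : ℝ in 𝓝[>] 0, ‖z + τ • h‖ < R := by
  have h1 : Continuous fun τ : ℝ => ‖z + τ • h‖ := by fun_prop
  have h2 := h1.tendsto 0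
  simp only [zero_smul, add_zero] at h2
  exact (h2.mono_left nhdsWithin_le_nhds).eventually_lt_const hz

/-- Minty's trick. -/
theorem eq_of_forall (hG : SemiMonotone R σ c G) {a : StrongDual ℝ X} {z : X} (hz : ‖z‖ < R)
    (ha : ∀ x, ‖x‖ ≤ R → -c (σ (z - x)) ≤ (a - G x) (z - x)) : a = G z := by
  have key : ∀ h, a h ≤ G z h := by
    intro h
    have h1 := (hG.tendsto_radial z h).add (hG.tendsto_gauge (apply_nonneg σ h))
    rw [add_zero] at h1
    refine ge_of_tendsto h1 ?_
    filter_upwards [self_mem_nhdsWithin, eventually_norm_le hz h] with τ hτ hn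
    have hτ : 0 < τ := hτ
    -- Test at `z + τ h`, divide by `τ` and let `τ → 0⁺`: the gauge term vanishes because `c(t)/t →
    -- 0`, and radial continuity handles `G`.
    have h2 := ha (z + τ • h) hn.le
    have h3 : z - (z + τ • h) = -(τ • h) := by abel
    rw [h3, map_neg_eq_map, map_smul_eq_mul, Real.norm_of_nonneg hτ.le] at h2
    simp only [map_neg, map_smul, smul_eq_mul, sub_apply] at h2
    have h4 : a h * τ ≤ G (z + τ • h) h * τ + c (τ * σ h) := by linarith
    have h5 : c (τ * σ h) = c (τ * σ h) / τ * τ := by field_simp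
    rw [h5, ← add_mul] at h4
    exact le_of_mul_le_mul_right h4 hτ
  ext h
  refine le_antisymm (key h) ?_
  have := key (-h)
  simp only [map_neg] at this
  linarith

/-- Minty's trick with `a = 0`, in contrapositive form. The inequality evaluates `G` only at the
fixed point `x`, so for continuous `σ` it persists for nearby `z` although `G` may be discontinuous.
-/
theorem exists_lt_of_ne_zero (hG : SemiMonotone R σ c G) {z : X} (hz : ‖z‖ < R) (h0 : G z ≠ 0) :
    ∃ x, ‖x‖ ≤ R ∧ G x (x - z) < -c (σ (x - z)) := by
  by_contra! hcon
  refine h0 (hG.eq_of_forall (a := 0) hz fun x hx => ?_).symm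
  have h1 := hcon x hx
  rw [← map_neg_eq_map σ, neg_sub]
  have h2 : (0 - G x) (z - x) = G x (x - z) := by
    simp
  rwa [h2]

/-- The finite-dimensional existence theorem for semimonotone operators. -/
theorem exists_eq_zero [FiniteDimensional ℝ X] (hG : SemiMonotone R σ c G) (hσ : Continuous σ)
    {lam : ℝ} (hlam : 0 < lam) (hR : lam < R) (hacute : ∀ z, lam < ‖z‖ → 0 ≤ G z z) :
    ∃ z, ‖z‖ ≤ lam ∧ G z = 0 := by
  classical
  by_contra! hcon
  -- Admissible directions at `z`. Between radii `lam` and `R` the acute angle condition is not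
  -- strict, so negative multiples of `z` are adjoined to the open half-space; the union stays
  -- convex because `G z (-z) ≤ 0`.
  let t : X → Set X := fun z =>
    if R ≤ ‖z‖ then {-z} else {d | G z d < 0 ∨ (lam < ‖z‖ ∧ ∃ s > (0 : ℝ), d = -(s • z))}
  have htneg : ∀ z, lam < ‖z‖ → -z ∈ t z := by
    intro z hz
    by_cases hRz : R ≤ ‖z‖
    · simp [t, hRz]
    · simp only [t, hRz, if_false]
      exact Or.inr ⟨hz, 1, one_pos, by simp⟩
  have htconv : ∀ z, Convex ℝ (t z) := by
    intro z
    by_cases hRz : R ≤ ‖z‖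
    · simp only [t, hRz, if_true]
      exact convex_singleton _
    simp only [t, hRz, if_false]
    rw [convex_iff_forall_pos]
    rintro d hd e he a b ha hb hab
    simp only [mem_ofPred_eq, map_add, map_smul, smul_eq_mul]
    rcases hd with hd | ⟨hz, s, hs, rfl⟩ <;> rcases he with he | ⟨hz', s', hs', rfl⟩
    · left
      nlinarith
    · left
      have h1 := mul_nonneg hs'.le (hacute z hz')
      simp only [map_neg, map_smul, smul_eq_mul]
      nlinarith
    · left
      have h1 := mul_nonneg hs.le (hacute z hz)
      simp only [map_neg, map_smul, smul_eq_mul]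
      nlinarith
    · right
      refine ⟨hz, a * s + b * s', by positivity, ?_⟩
      module
  have htloc : ∀ z : X, ∃ U ∈ 𝓝 z, ∃ g : X → X,
      ContMDiffOn (modelWithCornersSelf ℝ X) (modelWithCornersSelf ℝ X) (1 : ℕ∞) g U ∧
      ∀ y ∈ U, g y ∈ t y := by
    intro z
    by_cases hz : lam < ‖z‖
    · refine ⟨{y | lam < ‖y‖}, (isOpen_lt continuous_const continuous_norm).mem_nhds hz,
        fun y => -y, ?_, fun y hy => htneg y hy⟩
      rw [contMDiffOn_iff_contDiffOn]
      exact contDiff_neg.contDiffOn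
    · have hzR : ‖z‖ < R := (not_lt.mp hz).trans_lt hR
      obtain ⟨x, hxR, hx⟩ := hG.exists_lt_of_ne_zero hzR (hcon z (not_lt.mp hz))
      have hc : Continuous fun y => c (σ (x - y)) := by
        refine hG.continuousOn.comp_continuous (hσ.comp (by fun_prop)) fun y => ?_
        exact apply_nonneg σ _
      have hop : IsOpen {y | ‖y‖ < R ∧ G x (x - y) < -c (σ (x - y))} :=
        (isOpen_lt continuous_norm continuous_const).inter
          (isOpen_lt (by fun_prop) hc.neg)
      refine ⟨_, hop.mem_nhds ⟨hzR, hx⟩, fun y => x - y, ?_, fun y hy => ?_⟩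
      · rw [contMDiffOn_iff_contDiffOn]
        exact (contDiff_const.sub contDiff_id).contDiffOn
      · simp only [t, not_le.mpr hy.1, if_false]
        left
        -- The variation bound transfers the strict inequality from `G x` to `G y`: `G y (x - y) ≤ G
        -- x (x - y) + c (σ (x - y)) < 0`.
        have h1 := hG.bound x y hxR hy.1.le
        rw [sub_apply] at h1
        linarith [hy.2]
  obtain ⟨d, hd⟩ := exists_contMDiffMap_forall_mem_convex_of_local
    (modelWithCornersSelf ℝ X) htconv htloc
  have hdc : ContDiff ℝ 1 d := by
    have := d.contMDiff.contDiff
    exact_mod_cast this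
  have hdne : ∀ z, d z ≠ 0 := by
    intro z h0
    have h1 := hd z
    rw [h0] at h1
    by_cases hRz : R ≤ ‖z‖
    · simp only [t, hRz, if_true, mem_singleton_iff] at h1
      have : z = 0 := by simpa using h1.symm
      rw [this, norm_zero] at hRz
      linarith
    · simp only [t, hRz, if_false] at h1
      rcases h1 with h1 | ⟨hz, s, hs, h1⟩
      · simp at h1
      · have : z = 0 := by simpa [hs.ne'] using h1.symm
        rw [this, norm_zero] at hz
        linarith
  have hdid : ∀ z, R ≤ ‖z‖ → d z = -z := by
    intro z hz
    have h1 := hd z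
    simpa only [t, hz, if_true, mem_singleton_iff] using h1
  let e := toEuclidean (E := X)
  -- The field is carried to Euclidean coordinates. The `+ 1` keeps the factor positive even when
  -- `X` is trivial.
  obtain ⟨y, hy⟩ := exists_zero_of_eq_id_outside (V := EuclideanSpace ℝ (Fin (Module.finrank ℝ X)))
    (q := fun y => -e (d (e.symm y))) (r := (‖e.toContinuousLinearMap‖ + 1) * R)
    ((e.contDiff.comp (hdc.comp e.symm.contDiff)).neg) (by
      intro y hy
      have h1 : R ≤ ‖e.symm y‖ := by
        have h2 : ‖y‖ ≤ ‖e.toContinuousLinearMap‖ * ‖e.symm y‖ := by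
          simpa using e.toContinuousLinearMap.le_opNorm (e.symm y)
        have h3 : 0 < ‖e.toContinuousLinearMap‖ + 1 := by
          positivity
        refine le_of_mul_le_mul_left (hy.trans (h2.trans ?_)) h3
        nlinarith [norm_nonneg (e.symm y)]
      simp only [hdid _ h1, map_neg, neg_neg, ContinuousLinearEquiv.apply_symm_apply])
  exact hdne _ (by simpa using hy)

end SemiMonotone

end SemiMonotone

/-! ### Galerkin approximation and passage to the limit. -/

section Existence

variable {X : Type*} [NormedAddCommGroup X] [NormedSpace ℝ X]
  {R : ℝ} {σ : Seminorm ℝ X} {c : ℝ → ℝ} {G : X → StrongDual ℝ X}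
  {W : Type*} [AddCommGroup W] [Module ℝ W]

namespace SemiMonotone

/-- Restriction of a semimonotone operator to a subspace, perturbed by a monotone linear map. -/
theorem restrict_add (hG : SemiMonotone R σ c G) (Z : Submodule ℝ X)
    (L : Z →ₗ[ℝ] StrongDual ℝ X) (hL : ∀ z, 0 ≤ L z z) :
    SemiMonotone R (σ.comp Z.subtype) c fun z : Z => (L z + G z).comp Z.subtypeL where
  continuousOn := hG.continuousOn
  tendsto := hG.tendsto
  bound x y hx hy := by
    have h1 := hG.bound x y hx hy
    have h2 := hL (x - y)
    simp only [map_sub, sub_apply, Submodule.coe_sub] at h1 h2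
    simp only [Seminorm.comp_apply, Submodule.subtype_apply, map_sub, sub_apply,
      ContinuousLinearMap.comp_apply, Submodule.subtypeL_apply, add_apply]
    linarith
  radial x h := by
    obtain ⟨ε, hε, hc⟩ := hG.radial x h
    refine ⟨ε, hε, ?_⟩
    simp only [map_add, map_smul, ContinuousLinearMap.comp_apply, Submodule.subtypeL_apply,
      add_apply, Submodule.coe_add, Submodule.coe_smul, smul_apply]
    exact ContinuousOn.add (by fun_prop) hc

/-- The finite-dimensional problem lives on the image `i(S)` of the span. As `i` need not be
injective, a linear right inverse `T` turns the relation into the monotone linear map `k ∘ T` there.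
-/
theorem exists_galerkin (hG : SemiMonotone R σ c G) (hσ : Continuous σ) {lam : ℝ}
    (hlam : 0 < lam) (hR : lam < R) (hacute : ∀ z, lam < ‖z‖ → 0 ≤ G z z)
    (i : W →ₗ[ℝ] X) (k : W →ₗ[ℝ] StrongDual ℝ X) (hk : ∀ w, 0 ≤ k w (i w)) (s : Finset W) :
    ∃ v ∈ Submodule.span ℝ (s : Set W), ‖i v‖ ≤ lam ∧
      ∀ w ∈ Submodule.span ℝ (s : Set W), (k v + G (i v)) (i w) = 0 := by
  set S := Submodule.span ℝ (s : Set W)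
  have : FiniteDimensional ℝ S := FiniteDimensional.span_finset ℝ s
  obtain ⟨T, hT⟩ := LinearMap.exists_rightInverse_of_surjective (i.submoduleMap S)
    (LinearMap.range_eq_top.mpr (i.submoduleMap_surjective S))
  have hT' : ∀ z : S.map i, i (T z) = z := fun z => by
    have := congrArg (fun f : S.map i →ₗ[ℝ] S.map i => (f z : X)) hT
    simpa using this
  obtain ⟨z, hz, hz0⟩ := (hG.restrict_add (S.map i) (k ∘ₗ S.subtype ∘ₗ T) (fun z => by
    have := hk (T z)
    rwa [hT'] at this)).exists_eq_zero (hσ.comp continuous_subtype_val) hlam hR (fun z hz => by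
      have h1 := hk (T z)
      rw [hT'] at h1
      have h2 := hacute z hz
      simpa using add_nonneg h1 h2)
  refine ⟨T z, (T z).2, by rwa [hT'], fun w hw => ?_⟩
  have := congrArg (fun f : StrongDual ℝ (S.map i) => f ⟨i w, Submodule.mem_map_of_mem hw⟩) hz0
  rw [hT']
  simpa using this

/-- Comparing `x i` with a fixed `y` in the ball and using `G (x i) (x i) ≤ 0` bounds `G (x i) y`
from above. Replacing `y` by `-y` and rescaling gives pointwise bounds, and Banach–Steinhaus makes
them uniform. -/
theorem exists_norm_le [CompleteSpace X] (hG : SemiMonotone R σ c G) (hσ : IsCompactSeminorm σ)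
    (hR : 0 < R) {ι : Type*} {x : ι → X} (hx : ∀ i, ‖x i‖ ≤ R) (hGx : ∀ i, G (x i) (x i) ≤ 0) :
    ∃ M, ∀ i, ‖G (x i)‖ ≤ M := by
  have hball : ∀ y, ‖y‖ ≤ R → ∃ C, ∀ i, G (x i) y ≤ C := by
    intro y hy
    obtain ⟨A, hA, hσA⟩ := hσ.exists_le
    obtain ⟨C, hC⟩ := (isCompact_Icc (a := (0 : ℝ)) (b := A * (2 * R))).exists_bound_of_continuousOn
      (hG.continuousOn.mono Icc_subset_Ici_self)
    refine ⟨C + ‖G y‖ * (2 * R), fun i => ?_⟩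
    have hn : ‖x i - y‖ ≤ 2 * R := (norm_sub_le _ _).trans (by linarith [hx i])
    have h1 := hG.bound (x i) y (hx i) hy
    have h2 := hC (σ (x i - y)) ⟨apply_nonneg σ _, (hσA _).trans (by gcongr)⟩
    have h3 : -(G y (x i - y)) ≤ ‖G y‖ * (2 * R) := by
      refine (neg_le_abs _).trans (((G y).le_opNorm _).trans ?_)
      gcongr
    have h4 := le_abs_self (c (σ (x i - y)))
    rw [Real.norm_eq_abs] at h2
    rw [sub_apply, map_sub (G (x i))] at h1
    linarith [hGx i]
  refine banach_steinhaus fun y => ?_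
  have hpos : 0 < ‖y‖ + 1 := by positivity
  set ρ := R / (‖y‖ + 1)
  have hρ : 0 < ρ := by positivity
  have hy : ‖ρ • y‖ ≤ R := by
    rw [norm_smul, Real.norm_of_nonneg hρ.le, div_mul_eq_mul_div, div_le_iff₀ hpos]
    nlinarith
  obtain ⟨C, hC⟩ := hball _ hy
  obtain ⟨C', hC'⟩ := hball (-(ρ • y)) (by rwa [norm_neg])
  refine ⟨(max C C') / ρ, fun i => ?_⟩
  have h1 := hC i
  have h2 := hC' i
  rw [map_neg] at h2
  rw [map_smul, smul_eq_mul] at h1 h2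
  rw [le_div_iff₀ hρ, Real.norm_eq_abs]
  rcases abs_cases (G (x i) y) with h | h <;> rw [h.1]
  · exact le_trans (by linarith) (le_max_left _ _)
  · exact le_trans (by linarith) (le_max_right _ _)

end SemiMonotone

theorem exists_tendsto_of_norm_le {ι : Type*} (l : Ultrafilter ι) {a : ι → StrongDual ℝ X} {M : ℝ}
    (ha : ∀ i, ‖a i‖ ≤ M) : ∃ b : StrongDual ℝ X, ∀ x, Tendsto (fun i => a i x) l (𝓝 (b x)) := by
  obtain ⟨b, -, hb⟩ := (WeakDual.isCompact_closedBall (0 : StrongDual ℝ X) M).ultrafilter_le_nhds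
    (l.map fun i => (a i).toWeakDual) (by
      simp only [le_principal_iff]
      refine Eventually.of_forall (f := (l : Filter ι)) fun i => ?_
      simpa using ha i)
  refine ⟨WeakDual.toStrongDual b, fun x => ?_⟩
  exact (WeakDual.eval_continuous x).continuousAt.tendsto.comp hb

theorem exists_tendsto_of_abs_le {ι : Type*} (l : Ultrafilter ι) {a : ι → ℝ} {M : ℝ}
    (ha : ∀ i, |a i| ≤ M) : ∃ b, Tendsto a l (𝓝 b) := by
  obtain ⟨b, -, hb⟩ := (isCompact_Icc (a := -M) (b := M)).ultrafilter_le_nhds (l.map a) (by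
      simp only [le_principal_iff]
      exact Eventually.of_forall (f := (l : Filter ι)) fun i => abs_le.mp (ha i))
  exact ⟨b, hb⟩

theorem tendsto_apply_of_weak {ι : Type*} (l : Ultrafilter ι) {x : ι → X} {M : ℝ}
    (hx : ∀ i, ‖x i‖ ≤ M) {z : X}
    (hz : ∀ K : Set X, Convex ℝ K → IsClosed K → (∀ᶠ i in (l : Filter ι), x i ∈ K) → z ∈ K)
    (f : StrongDual ℝ X) : Tendsto (fun i => f (x i)) l (𝓝 (f z)) := by
  obtain ⟨b, hb⟩ := exists_tendsto_of_abs_le l (a := fun i => f (x i)) (M := ‖f‖ * M) fun i =>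
    (f.le_opNorm _).trans (by gcongr; exact hx i)
  have : f z = b := by
    by_contra hne
    have hpos : 0 < dist (f z) b := dist_pos.mpr hne
    have h1 := hz (f ⁻¹' Metric.closedBall b (dist (f z) b / 2))
      ((convex_closedBall _ _).linear_preimage (f : X →ₗ[ℝ] ℝ))
      (Metric.isClosed_closedBall.preimage f.continuous)
      (hb.eventually (Metric.closedBall_mem_nhds _ (by positivity)))
    rw [mem_preimage, Metric.mem_closedBall] at h1
    linarith
  rwa [this]

/-- Existence of a solution of `0 ∈ L z + G z` for a linear maximal monotone relation
`L = {(i w, k w)}` and a semimonotone operator `G` satisfying an acute angle condition. -/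
theorem SemiMonotone.exists_solution [CompleteSpace X] {r : ℝ} (hX : ClarksonInequality X r)
    (hr : 0 < r) (hG : SemiMonotone R σ c G) (hσ : IsCompactSeminorm σ) {lam : ℝ}
    (hlam : 0 < lam) (hR : lam < R) (hacute : ∀ z, lam < ‖z‖ → 0 ≤ G z z)
    (i : W →ₗ[ℝ] X) (k : W →ₗ[ℝ] StrongDual ℝ X) (hk : ∀ w, 0 ≤ k w (i w))
    (hmax : ∀ (a : StrongDual ℝ X) (z : X), (∀ w, 0 ≤ (k w + a) (i w - z)) →
      ∃ w, i w = z ∧ k w = -a) :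
    ∃ w, k w = -G (i w) := by
  classical
  choose v hv hvn hv0 using hG.exists_galerkin hσ.continuous hlam hR hacute i k hk
  -- Along an ultrafilter all bounded quantities converge at once; being finer than `atTop`, it
  -- eventually puts each fixed `w` in the Galerkin space.
  let l : Ultrafilter (Finset W) := Ultrafilter.of atTop
  have hl : (l : Filter (Finset W)) ≤ atTop := Ultrafilter.of_le atTop
  set x : Finset W → X := fun s => i (v s)
  have hGx : ∀ s, G (x s) (x s) ≤ 0 := by
    intro s
    have h1 := hv0 s (v s) (hv s)
    rw [add_apply] at h1
    linarith [hk (v s)]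
  obtain ⟨M, hM⟩ := hG.exists_norm_le hσ (hlam.trans hR) (x := x)
    (fun s => (hvn s).trans hR.le) hGx
  obtain ⟨z, hz⟩ := hX.exists_weak_limit hr (l : Filter (Finset W)) x hvn
  obtain ⟨a, ha⟩ := exists_tendsto_of_norm_le l hM
  obtain ⟨b, hb⟩ := exists_tendsto_of_abs_le l (a := fun s => G (x s) (x s)) (M := M * lam)
    fun s => ((G (x s)).le_opNorm _).trans
      (mul_le_mul (hM s) (hvn s) (norm_nonneg _) ((norm_nonneg _).trans (hM s)))
  have hzn : ‖z‖ ≤ lam := by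
    have := hz (Metric.closedBall 0 lam) (convex_closedBall _ _) Metric.isClosed_closedBall
      (Eventually.of_forall fun s => mem_closedBall_zero_iff.mpr (hvn s))
    simpa using this
  have hineq : ∀ w, b ≤ k w (i w - z) + a (i w) := by
    intro w
    have h1 : Tendsto (fun s => k w (i w - x s) + G (x s) (i w)) l
        (𝓝 (k w (i w - z) + a (i w))) := by
      refine Tendsto.add ?_ (ha _)
      simp only [map_sub]
      exact tendsto_const_nhds.sub (tendsto_apply_of_weak l hvn hz (k w))
    refine le_of_tendsto_of_tendsto hb h1 ?_
    filter_upwards [hl (eventually_ge_atTop {w})] with s hs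
    have hw : w ∈ Submodule.span ℝ (s : Set W) :=
      Submodule.subset_span (by simpa using hs)
    -- The Galerkin equation tested with `w - v s`, combined with monotonicity of the relation at `w
    -- - v s`.
    have h2 := hv0 s (w - v s) (Submodule.sub_mem _ hw (hv s))
    have h3 := hk (w - v s)
    simp only [map_sub, add_apply, sub_apply] at h2 h3 ⊢
    simp only [x] at h2 h3 ⊢
    linarith
  -- If `a z < b`, then `hineq` lets maximality place `(z, -a)` in the relation; `hineq` at that
  -- very point says `b ≤ a z`.
  have hbz : b ≤ a z := by
    by_contra! hlt
    obtain ⟨w, hw, hkw⟩ := hmax a z fun w => by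
      have := hineq w
      rw [add_apply, map_sub a]
      linarith
    have := hineq w
    rw [hw, sub_self, map_zero, zero_add] at this
    linarith
  have hlim : ∀ y, ‖y‖ ≤ R → -c (σ (z - y)) ≤ b - a y - G y (z - y) := by
    intro y hy
    have h1 : Tendsto (fun s => -c (σ (x s - y))) l (𝓝 (-c (σ (z - y)))) := by
      refine Tendsto.neg ?_
      refine (hG.continuousOn _ (apply_nonneg σ (z - y))).tendsto.comp ?_
      exact tendsto_nhdsWithin_iff.mpr ⟨hσ.tendsto l hvn hz y,
        Eventually.of_forall fun s => apply_nonneg σ _⟩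
    have h2 : Tendsto (fun s => G (x s) (x s) - G (x s) y - G y (x s - y)) l
        (𝓝 (b - a y - G y (z - y))) := by
      refine (hb.sub (ha y)).sub ?_
      simp only [map_sub]
      exact (tendsto_apply_of_weak l hvn hz (G y)).sub_const _
    refine le_of_tendsto_of_tendsto' h1 h2 fun s => ?_
    have := hG.bound (x s) y ((hvn s).trans hR.le) hy
    rw [sub_apply, map_sub (G (x s))] at this
    exact this
  have haG : a = G z := hG.eq_of_forall (hzn.trans_lt hR) fun y hy => by
    have := hlim y hy
    rw [sub_apply, map_sub a]
    linarith
  -- Taking `y = z` in `hlim`, where the gauge is zero, gives the reverse inequality; this is what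
  -- the last use of maximality needs.
  have hzb : a z ≤ b := by
    have := hlim z (hzn.trans hR.le)
    rw [sub_self, map_zero, map_zero, hG.gauge_zero] at this
    linarith
  obtain ⟨w, hw, hkw⟩ := hmax a z fun w => by
    have := hineq w
    rw [add_apply, map_sub a]
    linarith
  exact ⟨w, by rw [hkw, hw, haG]⟩

/-- The Browder–Minty theorem. -/
theorem exists_eq_zero_of_monotone [CompleteSpace X] {r : ℝ} (hX : ClarksonInequality X r)
    (hr : 0 < r) {G : X → StrongDual ℝ X} (hmono : ∀ x y, 0 ≤ (G x - G y) (x - y))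
    (hrad : ∀ x h, Continuous fun τ : ℝ => G (x + τ • h) h) {lam : ℝ}
    (hlam : 0 < lam) (hacute : ∀ z, lam < ‖z‖ → 0 ≤ G z z) : ∃ z, G z = 0 := by
  have hσ : IsCompactSeminorm (0 : Seminorm ℝ X) := fun ε hε =>
    ⟨{0}, finite_singleton _, fun x _ => by simp [hε]⟩
  have hG : SemiMonotone (lam + 1) (0 : Seminorm ℝ X) (fun _ => 0) G :=
    ⟨continuousOn_const, by simp, fun x y _ _ => by simpa using hmono x y,
      fun x h => ⟨1, one_pos, (hrad x h).continuousOn⟩⟩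
  obtain ⟨z, hz⟩ := hG.exists_solution hX hr hσ hlam (by linarith) hacute LinearMap.id 0
    (by simp) (fun a z h => ⟨z, rfl, by
      ext x
      have h1 := h (z + x)
      have h2 := h (z - x)
      simp at h1 h2
      simp
      linarith⟩)
  exact ⟨z, by simpa using hz.symm⟩

end Existence

/-! ### Scalar inequalities for `|t|^(p-2) t`. -/

section Power

theorem two_le_toReal {p : ℝ≥0∞} (hp : 2 ≤ p) (hp' : p ≠ ⊤) : 2 ≤ p.toReal := by
  simpa using ENNReal.toReal_mono hp' hp

/-- In terms of squares: superadditivity of `t ↦ t^(r/2)`, the parallelogram identity, then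
convexity of the same power. -/
theorem clarkson_real {r : ℝ} (hr : 2 ≤ r) (a b : ℝ) :
    |(1 / 2) * (a + b)| ^ r + |(1 / 2) * (a - b)| ^ r ≤ (|a| ^ r + |b| ^ r) / 2 := by
  have hsq : ∀ t : ℝ, |t| ^ r = (t ^ 2) ^ (r / 2) := fun t => by
    rw [← sq_abs, ← Real.rpow_natCast, ← Real.rpow_mul (abs_nonneg t)]
    congr 1
    push_cast
    ring
  have hs : 1 ≤ r / 2 := by linarith
  simp only [hsq]
  refine (Real.add_rpow_le_rpow_add (sq_nonneg _) (sq_nonneg _) hs).trans ?_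
  have h := (convexOn_rpow hs).2 (sq_nonneg a : a ^ 2 ∈ Ici 0) (sq_nonneg b : b ^ 2 ∈ Ici 0)
    (show (0 : ℝ) ≤ 1 / 2 by norm_num) (show (0 : ℝ) ≤ 1 / 2 by norm_num) (by norm_num)
  simp only [smul_eq_mul] at h
  have h2 : (1 / 2 * (a + b)) ^ 2 + (1 / 2 * (a - b)) ^ 2 = 1 / 2 * a ^ 2 + 1 / 2 * b ^ 2 := by
    ring
  rw [h2]
  linarith

variable {p : ℝ≥0∞}

theorem continuous_pw (hp : 2 ≤ p.toReal) : Continuous (pw p) :=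
  (continuous_abs.rpow_const fun _ => Or.inr (by linarith)).mul continuous_id

theorem abs_pw (hp : 2 ≤ p.toReal) (t : ℝ) : |pw p t| = |t| ^ (p.toReal - 1) := by
  rw [pw, abs_mul, abs_of_nonneg (Real.rpow_nonneg (abs_nonneg t) _)]
  rcases eq_or_ne t 0 with rfl | ht
  · rw [abs_zero, mul_zero, Real.zero_rpow (by linarith)]
  · rw [← Real.rpow_add_one (abs_ne_zero.mpr ht)]
    congr 1
    ring

theorem pw_mul_self (hp : 2 ≤ p.toReal) (t : ℝ) : pw p t * t = |t| ^ p.toReal := by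
  rcases eq_or_ne t 0 with rfl | ht
  · rw [abs_zero, mul_zero, Real.zero_rpow (by linarith)]
  · rw [pw, mul_assoc, ← abs_mul_abs_self, ← sq, ← Real.rpow_natCast,
      ← Real.rpow_add (abs_pos.mpr ht)]
    congr 1
    push_cast
    ring

theorem pw_of_nonneg {t : ℝ} (ht : 0 ≤ t) : pw p t = t ^ (p.toReal - 2) * t := by
  rw [pw, abs_of_nonneg ht]

theorem pw_neg (t : ℝ) : pw p (-t) = -pw p t := by
  simp [pw]

theorem pw_le_pw_of_nonneg (hp : 2 ≤ p.toReal) {s t : ℝ} (hs : 0 ≤ s) (hst : s ≤ t) :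
    pw p s ≤ pw p t := by
  rw [pw_of_nonneg hs, pw_of_nonneg (hs.trans hst)]
  have : 0 ≤ p.toReal - 2 := by linarith
  have : 0 ≤ t ^ (p.toReal - 2) := Real.rpow_nonneg (hs.trans hst) _
  gcongr

theorem pw_nonneg {t : ℝ} (ht : 0 ≤ t) : 0 ≤ pw p t := by
  rw [pw_of_nonneg ht]
  positivity

theorem pw_mono (hp : 2 ≤ p.toReal) : Monotone (pw p) := by
  intro s t hst
  rcases le_total 0 s with hs | hs
  · exact pw_le_pw_of_nonneg hp hs hst
  · rcases le_total 0 t with ht | ht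
    · have h1 : 0 ≤ pw p (-s) := pw_nonneg (by linarith)
      rw [pw_neg] at h1
      linarith [pw_nonneg (p := p) ht]
    · have := pw_le_pw_of_nonneg hp (s := -t) (t := -s) (by linarith) (by linarith)
      rw [pw_neg, pw_neg] at this
      linarith

theorem pw_sub_mul_sub_nonneg (hp : 2 ≤ p.toReal) (s t : ℝ) :
    0 ≤ (pw p s - pw p t) * (s - t) := by
  rcases le_total s t with h | h
  · exact mul_nonneg_of_nonpos_of_nonpos (by linarith [pw_mono hp h]) (by linarith)
  · exact mul_nonneg (by linarith [pw_mono hp h]) (by linarith)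

theorem abs_pw_le (hp : 2 ≤ p.toReal) {s t : ℝ} (h : |s| ≤ t) : |pw p s| ≤ pw p t := by
  have h1 := pw_mono hp (abs_le.mp h).1
  have h2 := pw_mono hp (abs_le.mp h).2
  rw [pw_neg] at h1
  exact abs_le.mpr ⟨h1, h2⟩

end Power

/-! ### Clarkson's inequality and the duality pairing on `L^p`. -/

section Lebesgue

variable {S : Type*} [MeasurableSpace S] {μ : Measure S} {p q : ℝ≥0∞}

theorem memLp_pw (hp : 2 ≤ p) (hp' : p ≠ ⊤) (hpq : p.HolderConjugate q) {f : S → ℝ}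
    (hf : MemLp f p μ) : MemLp (fun x => pw p (f x)) q μ := by
  have hr := two_le_toReal hp hp'
  have hp0 : p ≠ 0 := fun h => by simp [h] at hp
  have h1 : (p / q).toReal = p.toReal - 1 := by
    rw [div_eq_mul_inv, ← ENNReal.HolderConjugate.sub_one_mul_inv p q hp', mul_left_comm,
      ENNReal.mul_inv_cancel hp0 hp', mul_one,
      ENNReal.toReal_sub_of_le (le_trans (by norm_num) hp) hp', ENNReal.toReal_one]
  have hq0 : q ≠ 0 := (ENNReal.HolderConjugate.pos q p).ne'
  have h2 : p / (p / q) = q := by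
    rw [ENNReal.div_div_cancel hp0 hp']
  have h3 := hf.norm_rpow_div (p / q)
  rw [h1, h2] at h3
  refine h3.of_le ((continuous_pw hr).comp_aestronglyMeasurable hf.1)
    (Eventually.of_forall fun x => ?_)
  rw [Real.norm_eq_abs, abs_pw hr, Real.norm_eq_abs]
  exact le_abs_self _

theorem norm_rpow_eq_integral [Fact (1 ≤ p)] (hp' : p ≠ ⊤) (f : Lp ℝ p μ) :
    ‖f‖ ^ p.toReal = ∫ x, |f x| ^ p.toReal ∂μ := by
  have hp0 : p ≠ 0 := fun h => by simpa [h] using (Fact.out : 1 ≤ p)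
  have hr : 0 < p.toReal := ENNReal.toReal_pos hp0 hp'
  have hnn : 0 ≤ ∫ x, ‖f x‖ ^ p.toReal ∂μ := integral_nonneg fun x => by positivity
  rw [Lp.norm_def, (Lp.memLp f).eLpNorm_eq_integral_rpow_norm hp0 hp',
    ENNReal.toReal_ofReal (by positivity), Real.rpow_inv_rpow hnn hr.ne']
  rfl

theorem integrable_abs_rpow (hp0 : p ≠ 0) (hp' : p ≠ ⊤) {f : S → ℝ} (hf : MemLp f p μ) :
    Integrable (fun x => |f x| ^ p.toReal) μ :=
  hf.integrable_norm_rpow hp0 hp'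

theorem clarksonInequality_Lp [Fact (1 ≤ p)] (hp : 2 ≤ p) (hp' : p ≠ ⊤) :
    ClarksonInequality (Lp ℝ p μ) p.toReal := by
  intro f g
  have hr := two_le_toReal hp hp'
  have hp0 : p ≠ 0 := fun h => by simp [h] at hp
  have hI : ∀ h : Lp ℝ p μ, Integrable (fun x => |h x| ^ p.toReal) μ := fun h =>
    integrable_abs_rpow hp0 hp' (Lp.memLp h)
  simp only [norm_rpow_eq_integral hp']
  rw [← integral_add (hI _) (hI _), ← integral_add (hI _) (hI _), ← integral_div]
  refine integral_mono_ae ((hI _).add (hI _)) (((hI _).add (hI _)).div_const _) ?_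
  filter_upwards [Lp.coeFn_smul (1 / 2 : ℝ) (f + g), Lp.coeFn_smul (1 / 2 : ℝ) (f - g),
    Lp.coeFn_add f g, Lp.coeFn_sub f g] with x h1 h2 h3 h4
  rw [h1, h2, Pi.smul_apply, Pi.smul_apply, h3, h4]
  exact clarkson_real hr _ _

theorem clarksonInequality_piLp [Fact (1 ≤ p)] (hp' : p ≠ ⊤) {ι : Type*} [Fintype ι]
    {X : Type*} [NormedAddCommGroup X] [NormedSpace ℝ X] (hX : ClarksonInequality X p.toReal) :
    ClarksonInequality (PiLp p fun _ : ι => X) p.toReal := by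
  have hp0 : p ≠ 0 := fun h => by simpa [h] using (Fact.out : 1 ≤ p)
  have hr : 0 < p.toReal := ENNReal.toReal_pos hp0 hp'
  have hn : ∀ f : PiLp p fun _ : ι => X, ‖f‖ ^ p.toReal = ∑ i, ‖f i‖ ^ p.toReal := fun f => by
    rw [PiLp.norm_eq_sum hr, one_div, Real.rpow_inv_rpow (by positivity) hr.ne']
  intro f g
  simp only [hn, ← Finset.sum_add_distrib, Finset.sum_div]
  exact Finset.sum_le_sum fun i _ => hX (f i) (g i)

theorem prod_norm_rpow [Fact (1 ≤ p)] (hp' : p ≠ ⊤)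
    {X Y : Type*} [NormedAddCommGroup X] [NormedAddCommGroup Y]
    (f : WithLp p (X × Y)) : ‖f‖ ^ p.toReal = ‖f.fst‖ ^ p.toReal + ‖f.snd‖ ^ p.toReal := by
  have hp0 : p ≠ 0 := fun h => by simpa [h] using (Fact.out : 1 ≤ p)
  have hr : 0 < p.toReal := ENNReal.toReal_pos hp0 hp'
  rw [WithLp.prod_norm_eq_add hr, one_div, Real.rpow_inv_rpow (by positivity) hr.ne']

theorem clarksonInequality_prod [Fact (1 ≤ p)] (hp' : p ≠ ⊤)
    {X Y : Type*} [NormedAddCommGroup X] [NormedSpace ℝ X] [NormedAddCommGroup Y] [NormedSpace ℝ Y]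
    (hX : ClarksonInequality X p.toReal) (hY : ClarksonInequality Y p.toReal) :
    ClarksonInequality (WithLp p (X × Y)) p.toReal := by
  intro f g
  simp only [prod_norm_rpow hp']
  have h1 := hX f.fst g.fst
  have h2 := hY f.snd g.snd
  simp only [WithLp.smul_fst, WithLp.smul_snd, WithLp.add_fst, WithLp.add_snd, WithLp.sub_fst,
    WithLp.sub_snd]
  linarith

/-- The duality pairing as a continuous bilinear map. -/
def dualL (μ : Measure S) (p q : ℝ≥0∞) [Fact (1 ≤ p)] [Fact (1 ≤ q)] [q.HolderConjugate p] :
    Lp ℝ q μ →L[ℝ] StrongDual ℝ (Lp ℝ p μ) :=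
  (ContinuousLinearMap.mul ℝ ℝ).lpPairing μ q p

theorem dualL_apply [Fact (1 ≤ p)] [Fact (1 ≤ q)] [q.HolderConjugate p] (v : Lp ℝ q μ)
    (z : Lp ℝ p μ) : dualL μ p q v z = ∫ x, v x * z x ∂μ := by
  simp [dualL, ContinuousLinearMap.lpPairing_eq_integral]

/-- Dominated convergence near `τ₀`: for `|τ| < T = |τ₀| + 1` the monotonicity of `pw` gives a
majorant that is integrable by Hölder. It yields radial continuity of both the duality map and the
state operator. -/
theorem continuous_integral_pw [q.HolderConjugate p] (hp : 2 ≤ p) (hp' : p ≠ ⊤) {u a b c : S → ℝ}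
    (hu : MemLp u ⊤ μ) (ha : MemLp a p μ) (hb : MemLp b p μ) (hc : MemLp c p μ) :
    Continuous fun τ : ℝ => ∫ x, u x * pw p (a x + τ * b x) * c x ∂μ := by
  have hr := two_le_toReal hp hp'
  have hpq : p.HolderConjugate q := inferInstance
  rw [continuous_iff_continuousAt]
  intro τ₀
  set T := |τ₀| + 1
  have hdom : MemLp (fun x => |a x| + T * |b x|) p μ := ha.abs.add (hb.abs.const_mul T)
  refine continuousAt_of_dominated (bound := fun x => |u x| * pw p (|a x| + T * |b x|) * |c x|)
    (Eventually.of_forall fun τ => ?_) ?_ ?_ (Eventually.of_forall fun x => ?_)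
  · exact (hu.1.mul ((continuous_pw hr).comp_aestronglyMeasurable
      (ha.1.add (hb.1.const_mul τ)))).mul hc.1
  · have : ∀ᶠ τ in 𝓝 τ₀, |τ| < T :=
      (continuous_abs.tendsto τ₀).eventually_lt_const (lt_add_one _)
    filter_upwards [this] with τ hτ
    refine Eventually.of_forall fun x => ?_
    rw [Real.norm_eq_abs, abs_mul, abs_mul]
    have h1 : |a x + τ * b x| ≤ |a x| + T * |b x| := by
      refine (abs_add_le _ _).trans ?_
      rw [abs_mul]
      gcongr
    have := abs_pw_le hr h1
    gcongr
  · exact MemLp.integrable_mul (p := q) (q := p)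
      ((memLp_pw hp hp' hpq hdom).mul (p := ⊤) (r := q) hu.abs) hc.abs
  · exact ((continuous_const.mul ((continuous_pw hr).comp (by fun_prop))).mul
      continuous_const).continuousAt

end Lebesgue

/-- Once `‖z‖ ≥ 1` and `m ‖z‖ ≥ ‖f‖`, one has `m ‖z‖^r ≥ m ‖z‖² ≥ ‖f‖ ‖z‖ ≥ f z`. -/
theorem exists_acute_of_coercive {X : Type*} [NormedAddCommGroup X] [NormedSpace ℝ X]
    {G : X → StrongDual ℝ X} {m r : ℝ} (hm : 0 < m) (hr : 2 ≤ r)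
    (hG : ∀ z, m * ‖z‖ ^ r ≤ G z z) (f : StrongDual ℝ X) :
    ∃ lam > 0, ∀ z, lam < ‖z‖ → 0 ≤ (G z - f) z := by
  refine ⟨max 1 (‖f‖ / m), lt_max_of_lt_left one_pos, fun z hz => ?_⟩
  have h1 : 1 ≤ ‖z‖ := (le_max_left _ _).trans hz.le
  have h2 : ‖f‖ ≤ m * ‖z‖ := by
    have := (le_max_right _ _).trans hz.le
    rwa [div_le_iff₀' hm] at this
  have h3 : ‖z‖ ^ 2 ≤ ‖z‖ ^ r := by
    rw [← Real.rpow_natCast]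
    exact Real.rpow_le_rpow_of_exponent_le h1 (by simpa using hr)
  have h4 : f z ≤ ‖f‖ * ‖z‖ := (le_abs_self _).trans (f.le_opNorm z)
  have h5 := hG z
  rw [sub_apply]
  nlinarith [norm_nonneg z]

/-! ### Riesz representation through Browder–Minty. -/

section Riesz

variable {S : Type*} [MeasurableSpace S] {μ : Measure S} {p q : ℝ≥0∞}

/-- The Riesz representation theorem for `L^p`, `2 ≤ p < ∞`. -/
theorem dualL_surjective [Fact (1 ≤ p)] [Fact (1 ≤ q)] [q.HolderConjugate p] (hp : 2 ≤ p)
    (hp' : p ≠ ⊤) : Function.Surjective (dualL μ p q) := by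
  intro f
  have hr := two_le_toReal hp hp'
  have hpq : p.HolderConjugate q := inferInstance
  -- The duality map `z ↦ |z|^(p-2) z` is monotone, coercive and radially continuous, so some `J z`
  -- represents `f`.
  let J : Lp ℝ p μ → Lp ℝ q μ := fun z => (memLp_pw hp hp' hpq (Lp.memLp z)).toLp
  have hJ : ∀ z w, dualL μ p q (J z) w = ∫ x, pw p (z x) * w x ∂μ := by
    intro z w
    rw [dualL_apply]
    refine integral_congr_ae ?_
    filter_upwards [(memLp_pw hp hp' hpq (Lp.memLp z)).coeFn_toLp] with x hx
    rw [hx]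
  have hI : ∀ z w : Lp ℝ p μ, Integrable (fun x => pw p (z x) * w x) μ := fun z w =>
    MemLp.integrable_mul (p := q) (q := p) (memLp_pw hp hp' hpq (Lp.memLp z)) (Lp.memLp w)
  have hcoer : ∀ z, 1 * ‖z‖ ^ p.toReal ≤ dualL μ p q (J z) z := by
    intro z
    rw [hJ, one_mul, norm_rpow_eq_integral hp']
    simp only [pw_mul_self hr, le_refl]
  obtain ⟨lam, hlam, hac⟩ := exists_acute_of_coercive one_pos hr hcoer f
  have hmono : ∀ x y, 0 ≤ ((dualL μ p q (J x) - f) - (dualL μ p q (J y) - f)) (x - y) := by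
    intro x y
    rw [sub_sub_sub_cancel_right, sub_apply, hJ, hJ, ← integral_sub (hI _ _) (hI _ _)]
    refine integral_nonneg_of_ae ?_
    filter_upwards [Lp.coeFn_sub x y] with t ht
    rw [ht, ← sub_mul]
    exact pw_sub_mul_sub_nonneg hr _ _
  have hrad : ∀ x h, Continuous fun τ : ℝ => (dualL μ p q (J (x + τ • h)) - f) h := by
    intro x h
    simp only [sub_apply, hJ]
    refine Continuous.sub ?_ continuous_const
    refine (continuous_integral_pw (q := q) (u := fun _ => 1) hp hp'
      (memLp_top_const 1) (Lp.memLp x) (Lp.memLp h) (Lp.memLp h)).congr fun τ => ?_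
    refine integral_congr_ae ?_
    filter_upwards [Lp.coeFn_add x (τ • h), Lp.coeFn_smul τ h] with t h1 h2
    rw [h1, Pi.add_apply, h2, one_mul]
    rfl
  obtain ⟨z, hz⟩ := exists_eq_zero_of_monotone (clarksonInequality_Lp hp hp')
    (by linarith) hmono hrad hlam hac
  exact ⟨J z, sub_eq_zero.mp hz⟩

end Riesz

/-! ### The Hammerstein equation for a fixed state. -/

section Hammerstein

variable {N : ℕ} {p q : ℝ≥0∞} [Fact (1 ≤ p)] [Fact (1 ≤ q)] {Ω : Set (E N)}

theorem dualL_eq_dual [q.HolderConjugate p] (v : L q Ω) (z : L p Ω) :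
    dualL (volume.restrict Ω) p q v z = dual v z :=
  dualL_apply v z

theorem eq_zero_of_forall_dualL_left [q.HolderConjugate p] {S : Type*} [MeasurableSpace S]
    {μ : Measure S} [IsFiniteMeasure μ] (hq : q ≠ ⊤) {v : Lp ℝ q μ}
    (h : ∀ z, dualL μ p q v z = 0) : v = 0 := by
  have hq0 : q ≠ 0 := (ENNReal.HolderConjugate.pos q p).ne'
  rw [Lp.eq_zero_iff_ae_eq_zero]
  refine Lp.ae_eq_zero_of_forall_setIntegral_eq_zero v hq0 hq (fun s _ _ =>
    ((Lp.memLp v).integrable Fact.out).integrableOn) fun s hs hμ => ?_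
  have h1 := h (indicatorConstLp p hs hμ.ne 1)
  rw [dualL_apply] at h1
  rw [← integral_indicator hs, ← h1]
  refine integral_congr_ae ?_
  filter_upwards [indicatorConstLp_coeFn (p := p) (hs := hs) (hμs := hμ.ne) (c := (1 : ℝ))]
    with x hx
  rw [hx]
  by_cases hxs : x ∈ s <;> simp [hxs]

theorem eq_zero_of_forall_dualL_right [q.HolderConjugate p] {S : Type*} [MeasurableSpace S]
    {μ : Measure S} [IsFiniteMeasure μ] (hp : p ≠ ⊤) {z : Lp ℝ p μ}
    (h : ∀ v, dualL μ p q v z = 0) : z = 0 := by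
  refine eq_zero_of_forall_dualL_left (p := q) (q := p) hp fun v => ?_
  rw [← h v, dualL_apply, dualL_apply]
  simp only [mul_comm]

theorem gauge_le_of_iInf_singleton {Y : Type*} {y : Y} {C : Y → ℝ} {d : ℝ}
    (h : -(⨅ y' ∈ ({y} : Set Y), ((C y' : ℝ) : EReal)) ≤ ((d : ℝ) : EReal)) : -C y ≤ d := by
  rw [iInf_singleton] at h
  exact_mod_cast h

/-- The graph of a positive operator `B : L^q → L^p` is maximal monotone. -/
theorem exists_of_forall_nonneg [q.HolderConjugate p] (hp : 2 ≤ p) (hp' : p ≠ ⊤)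
    {S : Type*} [MeasurableSpace S] {μ : Measure S} [IsFiniteMeasure μ]
    (B : Lp ℝ q μ →L[ℝ] Lp ℝ p μ) (a : StrongDual ℝ (Lp ℝ p μ)) (z : Lp ℝ p μ)
    (hv : ∀ v, 0 ≤ (dualL μ p q v + a) (B v - z)) : ∃ v, B v = z ∧ dualL μ p q v = -a := by
  obtain ⟨u, rfl⟩ := dualL_surjective (q := q) hp hp' a
  refine ⟨-u, ?_, map_neg _ _⟩
  rw [← sub_eq_zero]
  refine eq_zero_of_forall_dualL_right (q := q) hp' fun w => ?_
  have hlin : ∀ w, 0 ≤ dualL μ p q w (B (-u) - z) := by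
    intro w
    have h1 : ∀ t : ℝ, 0 < t → 0 ≤ dualL μ p q w (B (-u) - z) + t * dualL μ p q w (B w) := by
      intro t ht
      -- Perturb the candidate `-u` by `t w`; dividing by `t` and letting `t → 0⁺` removes the
      -- quadratic term, and the signs of `±w` force equality.
      have h2 := hv (-u + t • w)
      have h3 : dualL μ p q (-u + t • w) + dualL μ p q u = t • dualL μ p q w := by
        rw [← map_add, ← map_smul]
        congr 1
        abel
      have h4 : B (-u + t • w) - z = (B (-u) - z) + t • B w := by
        rw [map_add, map_smul]
        abel
      rw [h3, h4, smul_apply, map_add, map_smul, smul_eq_mul, smul_eq_mul] at h2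
      exact nonneg_of_mul_nonneg_right h2 ht
    have h5 : Tendsto (fun t : ℝ => dualL μ p q w (B (-u) - z) + t * dualL μ p q w (B w))
        (𝓝[>] 0) (𝓝 (dualL μ p q w (B (-u) - z) + 0 * dualL μ p q w (B w))) :=
      (tendsto_const_nhds.add (tendsto_id.mul_const _)).mono_left nhdsWithin_le_nhds
    rw [zero_mul, add_zero] at h5
    exact ge_of_tendsto h5 (by filter_upwards [self_mem_nhdsWithin] with t ht using h1 t ht)
  have h1 := hlin w
  have h2 := hlin (-w)
  rw [map_neg, neg_apply] at h2
  exact le_antisymm (by linarith) h1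

theorem HammersteinConditions.exists_semiMonotone [q.HolderConjugate p]
    {Y : Type*} [NormedAddCommGroup Y] {B : L q Ω →L[ℝ] L p Ω}
    {dom : Set (L p Ω)} {Binv : L p Ω → L q Ω} {F : Y → L p Ω → L q Ω} {g : L p Ω} {y : Y}
    (h : HammersteinConditions B dom Binv F g {y}) {R : ℝ} (hR : 0 < R) :
    ∃ (σ : Seminorm ℝ (L p Ω)) (c : ℝ → ℝ), IsCompactSeminorm σ ∧
      SemiMonotone R σ c fun z => dualL (volume.restrict Ω) p q (F y z - Binv g) := by
  obtain ⟨σ, C, hσ, hC, hbound⟩ := h.usbv {y} Bornology.isBounded_singleton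
  obtain ⟨hCc, hCt⟩ := hC y rfl
  refine ⟨σ, C y R, hσ, ?_, hCt _ hR, fun z₁ z₂ h1 h2 => ?_, fun z w => ?_⟩
  · exact hCc.comp (f := fun t : ℝ => (R, t)) (by fun_prop) fun t ht => ⟨hR.le, ht⟩
  · have h3 := gauge_le_of_iInf_singleton (C := fun y' => C y' R (σ (z₁ - z₂)))
      (hbound y rfl R z₁ z₂ h1 h2)
    rw [← map_sub, sub_sub_sub_cancel_right, dualL_eq_dual]
    exact h3
  · obtain ⟨ε, hε, hc⟩ := h.radial y rfl z w
    refine ⟨ε, hε, ?_⟩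
    simp only [map_sub, sub_apply]
    refine ContinuousOn.sub ?_ continuousOn_const
    simpa only [dualL_eq_dual] using hc

/-- Solvability of the Hammerstein equation `z + B F(y, z) = g` for a fixed `y`. -/
theorem HammersteinConditions.exists_solution [q.HolderConjugate p] (hp : 2 ≤ p) (hp' : p ≠ ⊤)
    (hΩ : volume Ω ≠ ⊤) {Y : Type*} [NormedAddCommGroup Y] {B : L q Ω →L[ℝ] L p Ω}
    {dom : Set (L p Ω)} {Binv : L p Ω → L q Ω} {F : Y → L p Ω → L q Ω} {g : L p Ω} {y : Y}
    (h : HammersteinConditions B dom Binv F g {y}) : ∃ z, z + B (F y z) = g := by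
  have : IsFiniteMeasure (volume.restrict Ω) := ⟨by simpa using hΩ.lt_top⟩
  have hr := two_le_toReal hp hp'
  have hq' : q ≠ ⊤ := by
    rw [ENNReal.HolderConjugate.ne_top_iff_ne_one q p]
    rintro rfl
    norm_num at hp
  obtain ⟨lam, hlam, hac⟩ := h.acute
  -- Minty's trick needs the solution strictly inside the ball of the variation bound, hence a
  -- radius exceeding `lam`.
  obtain ⟨σ, c, hσ, hG⟩ := h.exists_semiMonotone (R := lam + 1) (by linarith)
  obtain ⟨v, hv⟩ := hG.exists_solution (clarksonInequality_Lp hp hp') (by linarith) hσ hlam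
    (by linarith) (fun z hz => (hac y rfl z hz).trans_eq (dualL_eq_dual _ _).symm)
    B.toLinearMap (dualL (volume.restrict Ω) p q).toLinearMap
    (fun w => (h.positive w).trans_eq (dualL_eq_dual _ _).symm)
    (fun a z hv => exists_of_forall_nonneg hp hp' B a z hv)
  refine ⟨B v, ?_⟩
  have h1 : v + (F y (B v) - Binv g) = 0 := by
    refine eq_zero_of_forall_dualL_left (p := p) hq' fun z => ?_
    have h2 : dualL (volume.restrict Ω) p q v =
      -dualL (volume.restrict Ω) p q (F y (B v) - Binv g) := hv
    rw [map_add, h2, neg_add_cancel, zero_apply]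
  have h2 := congrArg B h1
  rw [map_add, map_sub, map_zero, h.right_inverse g h.mem_dom] at h2
  rw [← sub_eq_zero, ← h2]
  abel

end Hammerstein

/-! ### The state equation in `W₀^{1,p}(Ω)`. -/

section StateOperator

variable {N : ℕ} {p q : ℝ≥0∞} [Fact (1 ≤ p)] {Ω D : Set (E N)}

/-- The weak partial derivative as a continuous linear map. -/
def weakDerivL (i : Fin N) : W0 p Ω →L[ℝ] Lp ℝ p (volume : Measure (E N)) :=
  (PiLp.proj (𝕜 := ℝ) p (fun _ : Fin N => Lp ℝ p (volume : Measure (E N))) i).comp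
    ((WithLp.sndL p ℝ _ _).comp (W0 p Ω).subtypeL)

/-- The underlying function as a continuous linear map. -/
def fnValL : W0 p Ω →L[ℝ] Lp ℝ p (volume : Measure (E N)) :=
  (WithLp.fstL p ℝ _ _).comp (W0 p Ω).subtypeL

/-- Restriction to the complement of `Ω` is continuous, so its kernel is closed and passes from test
functions to their closure. This turns the norm, defined over `ℝ^N`, into integrals over `Ω`, as
coercivity requires. -/
theorem ae_eq_zero_of_testPairs (hΩ : MeasurableSet Ω)
    (T : SobolevPair N p →L[ℝ] Lp ℝ p (volume : Measure (E N)))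
    (hT : ∀ w ∈ testPairs p Ω, ∀ᵐ x ∂volume, x ∉ Ω → T w x = 0) (y : W0 p Ω) :
    ∀ᵐ x ∂volume, x ∉ Ω → T y x = 0 := by
  let r := (LpToLpRestrictCLM (E N) ℝ ℝ volume p Ωᶜ).comp T
  have hle : W0 p Ω ≤ r.ker := by
    refine Submodule.topologicalClosure_minimal _ (fun w hw => ?_) r.isClosed_ker
    rw [LinearMap.mem_ker, Lp.eq_zero_iff_ae_eq_zero]
    filter_upwards [LpToLpRestrictCLM_coeFn ℝ Ωᶜ (T w),
      (ae_restrict_iff' hΩ.compl).mpr (hT w hw)] with x h1 h2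
    exact h1.trans h2
  have h0 : r y = 0 := hle y.2
  rw [Lp.eq_zero_iff_ae_eq_zero] at h0
  refine (ae_restrict_iff' hΩ.compl).mp ?_
  filter_upwards [LpToLpRestrictCLM_coeFn ℝ Ωᶜ (T y), h0] with x h1 h2
  exact h1.symm.trans h2

theorem IsTestFunction.eq_zero {φ : E N → ℝ} (hφ : IsTestFunction Ω φ) {x : E N} (hx : x ∉ Ω) :
    φ x = 0 :=
  image_eq_zero_of_notMem_tsupport fun h => hx (hφ.support h)

theorem IsTestFunction.partialDeriv_eq_zero {φ : E N → ℝ} (hφ : IsTestFunction Ω φ) (i : Fin N)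
    {x : E N} (hx : x ∉ Ω) : partialDeriv i φ x = 0 := by
  have : fderiv ℝ φ x = 0 := by
    by_contra h
    exact hx (hφ.support (support_fderiv_subset ℝ h))
  simp [partialDeriv, this]

theorem fnVal_ae_eq_zero (hΩ : MeasurableSet Ω) (y : W0 p Ω) : ∀ᵐ x ∂volume, x ∉ Ω → fnVal y x = 0 := by
  refine ae_eq_zero_of_testPairs hΩ (WithLp.fstL p ℝ _ _) ?_ y
  rintro w ⟨φ, hφ, hw, -⟩
  filter_upwards [hw] with x hx hxΩ
  exact hx.trans (hφ.eq_zero hxΩ)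

theorem weakDeriv_ae_eq_zero (hΩ : MeasurableSet Ω) (y : W0 p Ω) (i : Fin N) :
    ∀ᵐ x ∂volume, x ∉ Ω → weakDeriv y i x = 0 := by
  refine ae_eq_zero_of_testPairs hΩ ((PiLp.proj (𝕜 := ℝ) p
    (fun _ : Fin N => Lp ℝ p (volume : Measure (E N))) i).comp (WithLp.sndL p ℝ _ _)) ?_ y
  rintro w ⟨φ, hφ, -, hw⟩
  filter_upwards [hw i] with x hx hxΩ
  exact hx.trans (hφ.partialDeriv_eq_zero i hxΩ)

theorem norm_rpow_eq_setIntegral (hp' : p ≠ ⊤) (f : Lp ℝ p (volume : Measure (E N)))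
    (hf : ∀ᵐ x ∂volume, x ∉ Ω → f x = 0) :
    ‖f‖ ^ p.toReal = ∫ x in Ω, |f x| ^ p.toReal := by
  have hp0 : p ≠ 0 := fun h => by simpa [h] using (Fact.out : 1 ≤ p)
  have hr : p.toReal ≠ 0 := (ENNReal.toReal_pos hp0 hp').ne'
  rw [norm_rpow_eq_integral hp']
  refine (setIntegral_eq_integral_of_ae_compl_eq_zero ?_).symm
  filter_upwards [hf] with x hx hxΩ
  rw [hx hxΩ, abs_zero, Real.zero_rpow hr]

theorem W0_norm_rpow (hΩ : MeasurableSet Ω) (hp' : p ≠ ⊤) (y : W0 p Ω) :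
    ‖y‖ ^ p.toReal = (∫ x in Ω, |fnVal y x| ^ p.toReal) +
      ∑ i, ∫ x in Ω, |weakDeriv y i x| ^ p.toReal := by
  have hp0 : p ≠ 0 := fun h => by simpa [h] using (Fact.out : 1 ≤ p)
  have hr : 0 < p.toReal := ENNReal.toReal_pos hp0 hp'
  change ‖(y : SobolevPair N p)‖ ^ p.toReal = _
  rw [prod_norm_rpow hp', PiLp.norm_eq_sum hr, one_div, Real.rpow_inv_rpow (by positivity) hr.ne']
  congr 1
  · exact norm_rpow_eq_setIntegral hp' _ (fnVal_ae_eq_zero hΩ y)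
  · exact Finset.sum_congr rfl fun i _ =>
      norm_rpow_eq_setIntegral hp' _ (weakDeriv_ae_eq_zero hΩ y i)

theorem clarksonInequality_W0 (hp : 2 ≤ p) (hp' : p ≠ ⊤) :
    ClarksonInequality (W0 p Ω) p.toReal := fun y v =>
  clarksonInequality_prod hp' (clarksonInequality_Lp hp hp')
    (clarksonInequality_piLp hp' (clarksonInequality_Lp hp hp')) (y : SobolevPair N p) v

omit [Fact (1 ≤ p)] in
theorem memLp_restrict (f : Lp ℝ p (volume : Measure (E N))) :
    MemLp f p (volume.restrict Ω) :=
  (Lp.memLp f).restrict Ω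

variable (hΩD : Ω ⊆ D) (U : LinftyMatrix D)

include hΩD in
theorem memLp_top_restrict (i j : Fin N) : MemLp (U i j) ⊤ (volume.restrict Ω) :=
  (Lp.memLp (U i j)).mono_measure (Measure.restrict_mono hΩD le_rfl)

omit [Fact (1 ≤ p)] in
include hΩD in
theorem memLp_flux [hpq : q.HolderConjugate p] (hp : 2 ≤ p) (hp' : p ≠ ⊤)
    (w : Lp ℝ p (volume : Measure (E N))) (i j : Fin N) :
    MemLp (fun x => U i j x * pw p (w x)) q (volume.restrict Ω) :=
  (memLp_pw (q := q) hp hp' inferInstance (memLp_restrict w)).mul' (p := ⊤) (memLp_top_restrict hΩD U i j)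

theorem exists_integral_functional [Fact (1 ≤ q)] [q.HolderConjugate p] {h : E N → ℝ}
    (hh : MemLp h q (volume.restrict Ω)) (T : W0 p Ω →L[ℝ] Lp ℝ p (volume : Measure (E N))) :
    ∃ L : StrongDual ℝ (W0 p Ω), ∀ v, L v = ∫ x in Ω, h x * T v x := by
  refine ⟨((dualL (volume.restrict Ω) p q hh.toLp).comp
    (LpToLpRestrictCLM (E N) ℝ ℝ volume p Ω)).comp T, fun v => ?_⟩
  rw [ContinuousLinearMap.comp_apply, ContinuousLinearMap.comp_apply, dualL_apply]
  refine integral_congr_ae ?_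
  filter_upwards [hh.coeFn_toLp, LpToLpRestrictCLM_coeFn ℝ Ω (T v)] with x h1 h2
  rw [h1, h2]

include hΩD in
theorem exists_pairA_functional [Fact (1 ≤ q)] [q.HolderConjugate p] (hp : 2 ≤ p) (hp' : p ≠ ⊤)
    (y : W0 p Ω) : ∃ L : StrongDual ℝ (W0 p Ω), ∀ v, L v = pairA U y v := by
  choose L hL using fun i j => exists_integral_functional (q := q)
    (memLp_flux hΩD U hp hp' (weakDeriv y j) i j) (weakDerivL (p := p) (Ω := Ω) i)
  obtain ⟨L₀, hL₀⟩ := exists_integral_functional (q := q)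
    (memLp_pw (q := q) hp hp' inferInstance (memLp_restrict (Ω := Ω) (fnVal y)))
    (fnValL (p := p) (Ω := Ω))
  refine ⟨∑ i, ∑ j, L i j + L₀, fun v => ?_⟩
  simp only [add_apply, sum_apply, hL, hL₀]
  rfl

omit [Fact (1 ≤ p)] in
include hΩD in
theorem integrable_flux [q.HolderConjugate p] (hp : 2 ≤ p) (hp' : p ≠ ⊤)
    (w v : Lp ℝ p (volume : Measure (E N))) (i j : Fin N) :
    Integrable (fun x => U i j x * pw p (w x) * v x) (volume.restrict Ω) :=
  MemLp.integrable_mul (p := q) (q := p) (memLp_flux hΩD U hp hp' w i j) (memLp_restrict v)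

omit [Fact (1 ≤ p)] in
theorem integrable_pw_mul [q.HolderConjugate p] (hp : 2 ≤ p) (hp' : p ≠ ⊤)
    (w v : Lp ℝ p (volume : Measure (E N))) :
    Integrable (fun x => pw p (w x) * v x) (volume.restrict Ω) :=
  MemLp.integrable_mul (p := q) (q := p) (memLp_pw hp hp' inferInstance (memLp_restrict w))
    (memLp_restrict v)

include hΩD in
theorem pairA_eq_integral [q.HolderConjugate p] (hp : 2 ≤ p) (hp' : p ≠ ⊤) (y v : W0 p Ω) :
    pairA U y v = (∫ x in Ω, ∑ i, ∑ j, U i j x * pw p (weakDeriv y j x) * weakDeriv v i x) +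
      ∫ x in Ω, pw p (fnVal y x) * fnVal v x := by
  have hI := fun i j => integrable_flux (q := q) hΩD U hp hp' (weakDeriv y j) (weakDeriv v i) i j
  rw [pairA, integral_finsetSum _ fun i _ => integrable_finsetSum _ fun j _ => hI i j]
  congr 1
  exact Finset.sum_congr rfl fun i _ => (integral_finsetSum _ fun j _ => hI i j).symm

variable {U} {α β : ℝ}

include hΩD in
theorem pairA_monotone [q.HolderConjugate p] (hp : 2 ≤ p) (hp' : p ≠ ⊤) (hU : MClass p α β D U)
    (y v : W0 p Ω) : 0 ≤ pairA U y (y - v) - pairA U v (y - v) := by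
  have hr := two_le_toReal hp hp'
  have hI := fun (w : W0 p Ω) => integrable_finsetSum Finset.univ fun i _ =>
    integrable_finsetSum Finset.univ fun j _ =>
      integrable_flux (q := q) hΩD U hp hp' (weakDeriv w j) (weakDeriv (y - v) i) i j
  have hI₀ := fun (w : W0 p Ω) =>
    integrable_pw_mul (q := q) (Ω := Ω) hp hp' (fnVal w) (fnVal (y - v))
  rw [pairA_eq_integral (q := q) hΩD U hp hp', pairA_eq_integral (q := q) hΩD U hp hp',
    add_sub_add_comm, ← integral_sub (hI y) (hI v), ← integral_sub (hI₀ y) (hI₀ v)]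
  refine add_nonneg (integral_nonneg_of_ae ?_) (integral_nonneg_of_ae ?_)
  · have hsub : ∀ᵐ x ∂volume.restrict Ω, ∀ i,
        weakDeriv (y - v) i x = weakDeriv y i x - weakDeriv v i x :=
      ae_all_iff.mpr fun i => ae_restrict_of_ae (Lp.coeFn_sub (weakDeriv y i) (weakDeriv v i))
    filter_upwards [ae_restrict_of_ae_restrict_of_subset hΩD hU.monotone, hsub] with x h1 h2
    refine (h1 (fun j => weakDeriv y j x) (fun j => weakDeriv v j x)).trans_eq ?_
    simp only [h2, ← Finset.sum_sub_distrib]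
    exact Finset.sum_congr rfl fun i _ => Finset.sum_congr rfl fun j _ => by ring
  · filter_upwards [ae_restrict_of_ae (Lp.coeFn_sub (fnVal y) (fnVal v))] with x h1
    have h2 : fnVal (y - v) x = fnVal y x - fnVal v x := h1
    rw [h2, ← sub_mul]
    exact pw_sub_mul_sub_nonneg hr _ _

include hΩD in
theorem pairA_coercive [q.HolderConjugate p] (hΩ : MeasurableSet Ω) (hp : 2 ≤ p) (hp' : p ≠ ⊤) (hU : MClass p α β D U)
    (y : W0 p Ω) : min α 1 * ‖y‖ ^ p.toReal ≤ pairA U y y := by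
  have hr := two_le_toReal hp hp'
  have hp0 : p ≠ 0 := fun h => by simp [h] at hp
  have hI := integrable_finsetSum Finset.univ fun i _ =>
    integrable_finsetSum Finset.univ fun j _ =>
      integrable_flux (q := q) hΩD U hp hp' (weakDeriv y j) (weakDeriv y i) i j
  have hJ := fun i => integrable_abs_rpow hp0 hp' (memLp_restrict (Ω := Ω) (weakDeriv y i))
  have h1 : α * ∑ i, ∫ x in Ω, |weakDeriv y i x| ^ p.toReal ≤
      ∫ x in Ω, ∑ i, ∑ j, U i j x * pw p (weakDeriv y j x) * weakDeriv y i x := by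
    rw [← integral_finsetSum _ fun i _ => hJ i, ← integral_const_mul]
    refine integral_mono_ae ((integrable_finsetSum _ fun i _ => hJ i).const_mul α) hI ?_
    filter_upwards [ae_restrict_of_ae_restrict_of_subset hΩD hU.coercive] with x hx
    exact hx fun j => weakDeriv y j x
  rw [pairA_eq_integral (q := q) hΩD U hp hp', W0_norm_rpow hΩ hp', mul_add]
  simp only [pw_mul_self hr]
  have h2 : 0 ≤ ∫ x in Ω, |fnVal y x| ^ p.toReal := integral_nonneg fun x => by positivity
  have h3 : 0 ≤ ∑ i, ∫ x in Ω, |weakDeriv y i x| ^ p.toReal :=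
    Finset.sum_nonneg fun i _ => integral_nonneg fun x => by positivity
  nlinarith [min_le_left α 1, min_le_right α 1]

omit [Fact (1 ≤ p)] in
theorem coeFn_add_smul (f h : Lp ℝ p (volume : Measure (E N))) (τ : ℝ) :
    ∀ᵐ x ∂volume.restrict Ω, (f + τ • h) x = f x + τ * h x := by
  filter_upwards [ae_restrict_of_ae (Lp.coeFn_add f (τ • h)),
    ae_restrict_of_ae (Lp.coeFn_smul τ h)] with x h1 h2
  rw [h1, Pi.add_apply, h2]
  rfl

include hΩD in
theorem pairA_radial [q.HolderConjugate p] (hp : 2 ≤ p) (hp' : p ≠ ⊤) (y v : W0 p Ω) :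
    Continuous fun τ : ℝ => pairA U (y + τ • v) v := by
  refine Continuous.add (continuous_finsetSum _ fun i _ => continuous_finsetSum _ fun j _ => ?_) ?_
  · refine (continuous_integral_pw (q := q) hp hp' (memLp_top_restrict hΩD U i j)
      (memLp_restrict (weakDeriv y j)) (memLp_restrict (weakDeriv v j))
      (memLp_restrict (weakDeriv v i))).congr fun τ => integral_congr_ae ?_
    filter_upwards [coeFn_add_smul (Ω := Ω) (weakDeriv y j) (weakDeriv v j) τ] with x hx
    rw [← hx]
    rfl
  · refine (continuous_integral_pw (q := q) (u := fun _ => 1) hp hp' (memLp_top_const 1)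
      (memLp_restrict (fnVal y)) (memLp_restrict (fnVal v))
      (memLp_restrict (fnVal v))).congr fun τ => integral_congr_ae ?_
    filter_upwards [coeFn_add_smul (Ω := Ω) (fnVal y) (fnVal v) τ] with x hx
    rw [← hx, one_mul]
    rfl

include hΩD in
/-- Solvability of the state equation `A(U, y) = f`. -/
theorem exists_state [Fact (1 ≤ q)] [q.HolderConjugate p] (hΩ : MeasurableSet Ω) (hp : 2 ≤ p) (hp' : p ≠ ⊤) (hα : 0 < α)
    (hU : MClass p α β D U) (f : WDual p Ω) : ∃ y : W0 p Ω, ∀ v, pairA U y v = f v := by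
  choose A hA using fun y => exists_pairA_functional (q := q) (Ω := Ω) hΩD U hp hp' y
  have hr := two_le_toReal hp hp'
  have : CompleteSpace (W0 p Ω) := (Submodule.isClosed_topologicalClosure _).completeSpace_coe
  obtain ⟨lam, hlam, hac⟩ := exists_acute_of_coercive (lt_min hα one_pos) hr (G := A)
    (fun z => by rw [hA]; exact pairA_coercive (q := q) hΩD hΩ hp hp' hU z) f
  obtain ⟨y, hy⟩ := exists_eq_zero_of_monotone (G := fun y => A y - f)
    (clarksonInequality_W0 hp hp') (by linarith)
    (fun y v => by
      rw [sub_sub_sub_cancel_right, sub_apply, hA, hA]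
      exact pairA_monotone (q := q) hΩD hp hp' hU y v)
    (fun y v => by
      simp only [sub_apply, hA]
      exact (pairA_radial (q := q) hΩD hp hp' y v).sub continuous_const) hlam hac
  exact ⟨y, fun v => by rw [← hA, sub_eq_zero.mp hy]⟩

end StateOperator

end Hammerstein

end

/-! ### The existence theorem. -/

open Hammerstein in
theorem mainTheorem10 {N : ℕ} (hN : 1 ≤ N) {p q : ℝ≥0∞} [Fact (1 ≤ p)] [Fact (1 ≤ q)]
    (hp : 2 ≤ p) (hp' : p ≠ ⊤) (hpq : p.HolderConjugate q)
    {Ω D : Set (E N)} (hΩ : IsOpen Ω) (hD : IsOpen D) (hDb : Bornology.IsBounded D)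
    (hΩD : closure Ω ⊆ D)
    {α β : ℝ} (hα : 0 < α) (hαβ : α ≤ β)
    (ξ₁ ξ₂ : L ⊤ D) (hξ : ∀ᵐ x ∂volume.restrict D, 0 ≤ ξ₁ x ∧ ξ₁ x ≤ ξ₂ x)
    (Q : Fin N → Set (WDual p D))
    (hQ : ∀ i, (Q i).Nonempty ∧ IsCompact (Q i) ∧ Convex ℝ (Q i))
    (hUad : (Uad p α β D ξ₁ ξ₂ Q).Nonempty)
    (B : L q Ω →L[ℝ] L p Ω) (dom : Set (L p Ω)) (Binv : L p Ω → L q Ω)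
    (F : W0 p Ω → L p Ω → L q Ω)
    (f : WDual p D) (g : L p D)
    (hBF : ∀ Y₀ : Set (W0 p Ω), Bornology.IsBounded Y₀ →
      HammersteinConditions B dom Binv F
        (restrictL (subset_closure.trans hΩD) g) Y₀) :
    (XiSol (subset_closure.trans hΩD) α β ξ₁ ξ₂ Q B F f g).Nonempty := by
  have hsub : Ω ⊆ D := subset_closure.trans hΩD
  have : q.HolderConjugate p := hpq.symm
  obtain ⟨U, hU⟩ := hUad
  -- The functional on `D` acts on `W₀^{1,p}(Ω)` by composition with extension by zero.
  obtain ⟨y, hy⟩ := exists_state (q := q) hsub hΩ.measurableSet hp hp' hα hU.1.1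
    (f.comp ((W0 p Ω).subtypeL.codRestrict (W0 p D) fun v => W0_mono p hsub v.2))
  obtain ⟨z, hz⟩ := (hBF {y} Bornology.isBounded_singleton).exists_solution hp hp'
    (hDb.subset hsub).measure_lt_top.ne
  exact ⟨(U, y, z), hU, hy, hz⟩
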